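/- Let $\mathfrak X$ be a Cantor set with a compatible metric, $\Gamma$ a countable group, and $\Phi:\Gamma\to\mathrm{Homeo}(\mathfrak X)$ a minimal equicontinuous action. Write $\Gamma$ also for the image $\Phi(\Gamma)$ (for an effective action the two are identified). **Definitions.** A non-empty clopen set $U\subset\mathfrak X$ is *adapted* if for every $g\in\Gamma$ either $gU=U$ or $gU\cap U=\emptyset$; then $\Gamma_U=\{g\in\Gamma: gU\cap U\neq\emptyset\}$ is a subgroup. The action is *locally quasi-analytic* (LQA) if there is $\varepsilon>0$ such that for all adapted $V\subset U$ with $\operatorname{diam}U<\varepsilon$ and all $g_1,g_2\in\Gamma$, $g_1|_V=g_2|_V$ implies $g_1|_U=g_2|_U$; the same definition applies to actions of other groups. The *Ellis group* $\mathfrak G$ is the closure of $\Phi(\Gamma)$ in $\mathrm{Homeo}(\mathfrak X)$ for pointwise convergence; the action is *wild* if the action of $\mathfrak G$ on $\mathfrak X$ is not LQA. An *adapted neighborhood basis* $\mathcal U$ at $x$ is a strictly decreasing sequence of adapted sets $\mathfrak X=U_0\supsetneq U_1\supsetneq\cdots$ with $\bigcap_\ell U_\ell=\{x\}$. Given $x$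 and $\mathcal U$, put $\Gamma_\ell=\Gamma_{U_\ell}$, let $\widehat\Gamma_\ell$ be the closure of $\Gamma_\ell$ in $\mathfrak G$, let $\Gamma_x$, $\mathfrak G_x$ be the stabilizers of $x$, and, with $[h,g]=hgh^{-1}g^{-1}$, $$K_\ell=\{h\in\mathfrak G_x:[h,g]\in\mathfrak G_x\ \forall g\in\widehat\Gamma_\ell\},\qquad Z_\ell=\{h\in\mathfrak G_x:[h,g]=\mathrm{id}\ \forall g\in\widehat\Gamma_\ell\},$$ $$K^\Gamma_\ell=\{h\in\Gamma_x:[h,g]\in\Gamma_x\ \forall g\in\Gamma_\ell\},\qquad Z^\Gamma_\ell=\{h\in\Gamma_x:[h,g]=\mathrm{id}\ \forall g\in\Gamma_\ell\}.$$ These are increasing chains of groups with direct limits (unions) $\Upsilon_s=\varinjlim K_\ell$, $\Upsilon_c=\varinjlim Z_\ell$, $\Upsilon^\Gamma_s=\varinjlim K^\Gamma_\ell$, $\Upsilon^\Gamma_c=\varinjlim Z^\Gamma_\ell$, and $\Upsilon_c\subset\Upsilon_s$, $\Upsilon^\Gamma_c\subset\Upsilon^\Gamma_s$. The limit of a chain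 is *bounded* if all inclusions of the chain are isomorphisms from some index on. The action is *wild of finite type* (resp. *wild of flat type*, *dynamically wild*) if it is wild and, for some $x$ and $\mathcal U$, $\Upsilon_s$ is unbounded and all $K_\ell$ are finite (resp. $\Upsilon_c=\Upsilon_s$; $\Upsilon_c\neq\Upsilon_s$). It is *countably wild of finite type* (resp. *countably wild of flat type*, *countably dynamically wild*) if the action of $\Gamma$ is not LQA and, for some $x$ and $\mathcal U$, $\Upsilon^\Gamma_s$ is unbounded and all $K^\Gamma_\ell$ are finite (resp. $\Upsilon^\Gamma_c=\Upsilon^\Gamma_s$; $\Upsilon^\Gamma_c\neq\Upsilon^\Gamma_s$). An element $g\in\Gamma$ is *non-Hausdorff* at $x$ if $gx=x$, $g$ is not the identity on any open neighborhood of $x$, and every open neighborhood of $x$ contains a non-empty open set on which $g$ is the identity. The *germinal groupoid* is the set of germs $[g]_x$ ($g\in\Gamma$, $x\in\mathfrak X$) with the topology generated by the sets $\{[g]_x:x\in U\}$, $g\in\Gamma$, $U$ open. Two actions of $\Gamma$ are *conjugate* if there is a $\Gamma$-equivariant homeomorphism between the spaces. **Theorem.** The six wildness properties do not depend on the choice of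 $x$ and $\mathcal U$, and: 1. Being countably wild of finite type, countably wild of flat type, or countably dynamically wild is an invariant of the conjugacy class of the action. 2. If the action is countably wild of flat type, then its germinal groupoid is Hausdorff. 3. If $\Gamma$ has a non-Hausdorff element (at some point), then the action is countably dynamically wild. 4. If the action is countably dynamically wild, then it is dynamically wild. 5. If the action is wild of finite (resp. flat) type, then it is LQA or countably wild of finite (resp. flat) type. -/

import Mathlib

open Set Filter Topology

universe u v w

namespace CantorAction

/-! ### Group actions by homeomorphisms

An action of a group `Γ` on a space `X` is a homomorphism `Φ : Γ →* (X ≃ₜ X)` into the group of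
homeomorphisms, the product being composition. -/

/-- Every orbit is dense. -/
def IsMinimal {Γ : Type w} [Group Γ] {X : Type u} [TopologicalSpace X]
    (Φ : Γ →* (X ≃ₜ X)) : Prop :=
  ∀ x : X, Dense (Set.range fun γ : Γ => Φ γ x)

/-- Equicontinuity, with `δ` depending on `ε` only. -/
def IsEquicontinuous {Γ : Type w} [Group Γ] {X : Type u} [MetricSpace X]
    (Φ : Γ →* (X ≃ₜ X)) : Prop :=
  ∀ ε : ℝ, 0 < ε → ∃ δ : ℝ, 0 < δ ∧
    ∀ (γ : Γ) (x y : X), dist x y < δ → dist (Φ γ x) (Φ γ y) < ε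

/-- Two actions of the same group are conjugate if an equivariant homeomorphism exists. -/
def Conjugate {Γ : Type w} [Group Γ] {X : Type u} [TopologicalSpace X] {Y : Type v}
    [TopologicalSpace Y] (Φ : Γ →* (X ≃ₜ X)) (Ψ : Γ →* (Y ≃ₜ Y)) : Prop :=
  ∃ f : X ≃ₜ Y, ∀ (γ : Γ) (x : X), f (Φ γ x) = Ψ γ (f x)

/-- Adapted sets: non-empty clopen sets whose translates are equal to the set or disjoint
from it. -/
def IsAdapted {Γ : Type w} [Group Γ] {X : Type u} [TopologicalSpace X]
    (Φ : Γ →* (X ≃ₜ X)) (U : Set X) : Prop :=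
  IsClopen U ∧ U.Nonempty ∧ ∀ γ : Γ, Φ γ '' U = U ∨ Disjoint (Φ γ '' U) U

/-- Locally quasi-analytic actions. -/
def IsLQA {Γ : Type w} [Group Γ] {X : Type u} [MetricSpace X] (Φ : Γ →* (X ≃ₜ X)) : Prop :=
  ∃ ε : ℝ, 0 < ε ∧ ∀ U : Set X, IsAdapted Φ U → Metric.diam U < ε →
    ∀ V : Set X, IsAdapted Φ V → V ⊆ U →
      ∀ g₁ g₂ : Γ, Set.EqOn (Φ g₁) (Φ g₂) V → Set.EqOn (Φ g₁) (Φ g₂) U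

/-! ### The germinal groupoid -/

/-- `g` is a non-Hausdorff element at `x`. -/
def IsNonHausdorffAt {Γ : Type w} [Group Γ] {X : Type u} [TopologicalSpace X]
    (Φ : Γ →* (X ≃ₜ X)) (g : Γ) (x : X) : Prop :=
  Φ g x = x ∧
    (∀ W : Set X, IsOpen W → x ∈ W → ¬ Set.EqOn (Φ g) id W) ∧
    (∀ W : Set X, IsOpen W → x ∈ W →
      ∃ O : Set X, IsOpen O ∧ O.Nonempty ∧ O ⊆ W ∧ Set.EqOn (Φ g) id O)

/-- `[g]_x = [h]_y`: the base points agree, and so do `Φ g` and `Φ h` on an open neighbourhood. -/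
def germSetoid {Γ : Type w} [Group Γ] {X : Type u} [TopologicalSpace X]
    (Φ : Γ →* (X ≃ₜ X)) : Setoid (Γ × X) where
  r p q := p.2 = q.2 ∧ ∃ U : Set X, IsOpen U ∧ p.2 ∈ U ∧ Set.EqOn (Φ p.1) (Φ q.1) U
  iseqv :=
    { refl := fun p => ⟨rfl, Set.univ, isOpen_univ, Set.mem_univ _, fun _ _ => rfl⟩
      symm := by
        rintro ⟨g, x⟩ ⟨h, y⟩ ⟨hxy, U, hU, hx, he⟩
        exact ⟨hxy.symm, U, hU, hxy ▸ hx, he.symm⟩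
      trans := by
        rintro ⟨g, x⟩ ⟨h, y⟩ ⟨k, z⟩ ⟨hxy, U, hU, hx, he⟩ ⟨hyz, V, hV, hy, he'⟩
        refine ⟨hxy.trans hyz, U ∩ V, hU.inter hV, ⟨hx, hxy.symm ▸ hy⟩, fun t ht => ?_⟩
        exact (he ht.1).trans (he' ht.2) }

/-- The germinal groupoid: the set of all germs `[g]_x`. (Only this set of arrows and its
topology matter for the Hausdorff property.) -/
def GerminalGroupoid {Γ : Type w} [Group Γ] {X : Type u} [TopologicalSpace X]
    (Φ : Γ →* (X ≃ₜ X)) : Type (max u w) :=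
  Quotient (germSetoid Φ)

/-- The germ `[g]_x`. -/
def germ {Γ : Type w} [Group Γ] {X : Type u} [TopologicalSpace X]
    (Φ : Γ →* (X ≃ₜ X)) (g : Γ) (x : X) : GerminalGroupoid Φ :=
  Quotient.mk (germSetoid Φ) (g, x)

/-- The sheaf (étale) topology, generated by the sets `{[g]_x | x ∈ U}` with `U` open. -/
instance germTopology {Γ : Type w} [Group Γ] {X : Type u} [TopologicalSpace X]
    (Φ : Γ →* (X ≃ₜ X)) : TopologicalSpace (GerminalGroupoid Φ) :=
  TopologicalSpace.generateFrom
    {B | ∃ (g : Γ) (U : Set X), IsOpen U ∧ B = germ Φ g '' U}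

/-! ### The Ellis group -/

/-- The closure of a set of homeomorphisms, inside the group of homeomorphisms, for the topology
of pointwise convergence. -/
def pointwiseClosure {X : Type u} [TopologicalSpace X] (S : Set (X ≃ₜ X)) : Set (X ≃ₜ X) :=
  {φ | (φ : X → X) ∈ closure ((fun ψ : X ≃ₜ X => (ψ : X → X)) '' S)}

theorem subset_pointwiseClosure {X : Type u} [TopologicalSpace X] (S : Set (X ≃ₜ X)) :
    S ⊆ pointwiseClosure S :=
  fun _ hφ => subset_closure (Set.mem_image_of_mem _ hφ)

theorem mul_mem_pointwiseClosure {X : Type u} [TopologicalSpace X] (G : Subgroup (X ≃ₜ X))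
    {φ ψ : X ≃ₜ X} (hφ : φ ∈ pointwiseClosure (G : Set (X ≃ₜ X)))
    (hψ : ψ ∈ pointwiseClosure (G : Set (X ≃ₜ X))) :
    φ * ψ ∈ pointwiseClosure (G : Set (X ≃ₜ X)) := by
  have h1 : ∀ g ∈ G, g * ψ ∈ pointwiseClosure (G : Set (X ≃ₜ X)) := by
    intro g hg
    have hc : Continuous (fun f : X → X => fun x => g (f x)) := by fun_prop
    have h := map_mem_closure (t := (fun ψ : X ≃ₜ X => (ψ : X → X)) '' (G : Set (X ≃ₜ X))) hc hψ
      (by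
        rintro _ ⟨k, hk, rfl⟩
        exact ⟨g * k, G.mul_mem hg hk, rfl⟩)
    exact h
  have hc : Continuous (fun f : X → X => fun x => f (ψ x)) := by fun_prop
  have h2 := map_mem_closure (t := closure
    ((fun ψ : X ≃ₜ X => (ψ : X → X)) '' (G : Set (X ≃ₜ X)))) hc hφ (by
      rintro _ ⟨k, hk, rfl⟩
      exact h1 k hk)
  rw [closure_closure] at h2
  exact h2

theorem inv_mem_pointwiseClosure {Γ : Type w} [Group Γ] {X : Type u} [MetricSpace X]
    (Φ : Γ →* (X ≃ₜ X)) (hΦ : IsEquicontinuous Φ)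
    {φ : X ≃ₜ X} (hφ : φ ∈ pointwiseClosure (Φ.range : Set (X ≃ₜ X))) :
    φ⁻¹ ∈ pointwiseClosure (Φ.range : Set (X ≃ₜ X)) := by
  have himg : (fun ψ : X ≃ₜ X => (ψ : X → X)) '' (Φ.range : Set (X ≃ₜ X)) =
      Set.range (fun γ : Γ => (Φ γ : X → X)) := by
    ext f
    constructor
    · rintro ⟨_, ⟨γ, rfl⟩, rfl⟩
      exact ⟨γ, rfl⟩
    · rintro ⟨γ, rfl⟩
      exact ⟨Φ γ, ⟨γ, rfl⟩, rfl⟩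
  have hφ' : (φ : X → X) ∈ closure (Set.range (fun γ : Γ => (Φ γ : X → X))) := himg ▸ hφ
  have hne : (comap (fun γ : Γ => (Φ γ : X → X)) (𝓝 (φ : X → X))).NeBot := by
    rw [comap_neBot_iff]
    intro t ht
    obtain ⟨f, hft, γ, rfl⟩ := mem_closure_iff_nhds.1 hφ' t ht
    exact ⟨γ, hft⟩
  have ht : ∀ y : X, Tendsto (fun γ : Γ => Φ γ y)
      (comap (fun γ : Γ => (Φ γ : X → X)) (𝓝 (φ : X → X))) (𝓝 (φ y)) :=
    tendsto_pi_nhds.1 tendsto_comap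
  have hlim : Tendsto (fun γ : Γ => (Φ γ⁻¹ : X → X))
      (comap (fun γ : Γ => (Φ γ : X → X)) (𝓝 (φ : X → X))) (𝓝 ((φ⁻¹ : X ≃ₜ X) : X → X)) := by
    refine tendsto_pi_nhds.2 fun x => Metric.tendsto_nhds.2 fun ε hε => ?_
    obtain ⟨δ, hδ, h⟩ := hΦ ε hε
    filter_upwards [Metric.tendsto_nhds.1 (ht (φ⁻¹ x)) δ hδ] with γ hγ
    have e1 : φ (φ⁻¹ x) = x := φ.apply_symm_apply x
    have e2 : Φ γ⁻¹ (Φ γ (φ⁻¹ x)) = φ⁻¹ x := by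
      rw [map_inv]
      exact (Φ γ).symm_apply_apply _
    rw [e1, dist_comm] at hγ
    have := h γ⁻¹ _ _ hγ
    rwa [e2] at this
  refine mem_closure_of_tendsto hlim (Eventually.of_forall fun γ => ?_)
  exact ⟨Φ γ⁻¹, ⟨γ⁻¹, rfl⟩, rfl⟩

/-- The Ellis group of an equicontinuous action: the closure of `Φ(Γ)` in the group of
homeomorphisms, for pointwise convergence. It acts on `X` through its inclusion
`(ellisGroup Φ hΦ).subtype`. -/
def ellisGroup {Γ : Type w} [Group Γ] {X : Type u} [MetricSpace X]
    (Φ : Γ →* (X ≃ₜ X)) (hΦ : IsEquicontinuous Φ) : Subgroup (X ≃ₜ X) where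
  carrier := pointwiseClosure (Φ.range : Set (X ≃ₜ X))
  mul_mem' := mul_mem_pointwiseClosure Φ.range
  one_mem' := subset_pointwiseClosure _ Φ.range.one_mem
  inv_mem' := inv_mem_pointwiseClosure Φ hΦ

/-- The action is wild: the action of its Ellis group is not locally quasi-analytic. -/
def IsWild {Γ : Type w} [Group Γ] {X : Type u} [MetricSpace X]
    (Φ : Γ →* (X ≃ₜ X)) (hΦ : IsEquicontinuous Φ) : Prop :=
  ¬ IsLQA (ellisGroup Φ hΦ).subtype

/-! ### Stabilizer and centralizer chains -/

/-- Adapted neighbourhood bases at `x`. -/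
structure AdaptedBasis {Γ : Type w} [Group Γ] {X : Type u} [TopologicalSpace X]
    (Φ : Γ →* (X ≃ₜ X)) (x : X) where
  U : ℕ → Set X
  zero : U 0 = Set.univ
  adapted : ∀ n, IsAdapted Φ (U n)
  mem : ∀ n, x ∈ U n
  ssubset : ∀ n, U (n + 1) ⊂ U n
  iInter : ⋂ n, U n = {x}

/-- The isotropy subgroup at `x` of a group of homeomorphisms. -/
def pointStabilizer {X : Type u} [TopologicalSpace X] (G : Subgroup (X ≃ₜ X)) (x : X) :
    Subgroup (X ≃ₜ X) where
  carrier := {φ | φ ∈ G ∧ φ x = x}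
  mul_mem' := by
    rintro a b ⟨ha, hax⟩ ⟨hb, hbx⟩
    exact ⟨G.mul_mem ha hb, by rw [Homeomorph.mul_apply, hbx, hax]⟩
  one_mem' := ⟨G.one_mem, rfl⟩
  inv_mem' := by
    rintro a ⟨ha, hax⟩
    refine ⟨G.inv_mem ha, ?_⟩
    rw [Homeomorph.inv_apply, Homeomorph.symm_apply_eq, hax]

/-- The return times `{g | g U ∩ U ≠ ∅}`, as a set of homeomorphisms in `Φ(Γ)`.
Throughout, `Γ` is identified with its image `Φ(Γ)`, as is usual for effective actions. -/
def returnTimes {Γ : Type w} [Group Γ] {X : Type u} [TopologicalSpace X]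
    (Φ : Γ →* (X ≃ₜ X)) (U : Set X) : Set (X ≃ₜ X) :=
  {φ | φ ∈ Φ.range ∧ (φ '' U ∩ U).Nonempty}

/-- `{h ∈ D | [h, g] ∈ D for all g ∈ H}`, where `[h, g] = h g h⁻¹ g⁻¹`. -/
def stabilizerSubgroup {A : Type u} [Group A] (D : Subgroup A) (H : Set A) : Subgroup A where
  carrier := {h | h ∈ D ∧ ∀ g ∈ H, h * g * h⁻¹ * g⁻¹ ∈ D}
  mul_mem' := by
    rintro a b ⟨ha, ha'⟩ ⟨hb, hb'⟩
    refine ⟨D.mul_mem ha hb, fun g hg => ?_⟩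
    have e : a * b * g * (a * b)⁻¹ * g⁻¹ =
        a * (b * g * b⁻¹ * g⁻¹) * a⁻¹ * (a * g * a⁻¹ * g⁻¹) := by group
    rw [e]
    exact D.mul_mem (D.mul_mem (D.mul_mem ha (hb' g hg)) (D.inv_mem ha)) (ha' g hg)
  one_mem' := ⟨D.one_mem, fun g _ => by
    rw [show (1 : A) * g * 1⁻¹ * g⁻¹ = 1 by group]; exact D.one_mem⟩
  inv_mem' := by
    rintro a ⟨ha, ha'⟩
    refine ⟨D.inv_mem ha, fun g hg => ?_⟩
    have e : a⁻¹ * g * a⁻¹⁻¹ * g⁻¹ = a⁻¹ * (a * g * a⁻¹ * g⁻¹)⁻¹ * a := by group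
    rw [e]
    exact D.mul_mem (D.mul_mem (D.inv_mem ha) (D.inv_mem (ha' g hg))) ha

/-- `{h ∈ D | [h, g] = id for all g ∈ H}`, where `[h, g] = h g h⁻¹ g⁻¹`. -/
def centralizerSubgroup {A : Type u} [Group A] (D : Subgroup A) (H : Set A) : Subgroup A where
  carrier := {h | h ∈ D ∧ ∀ g ∈ H, h * g * h⁻¹ * g⁻¹ = 1}
  mul_mem' := by
    rintro a b ⟨ha, ha'⟩ ⟨hb, hb'⟩
    refine ⟨D.mul_mem ha hb, fun g hg => ?_⟩
    have e : a * b * g * (a * b)⁻¹ * g⁻¹ =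
        a * (b * g * b⁻¹ * g⁻¹) * a⁻¹ * (a * g * a⁻¹ * g⁻¹) := by group
    rw [e, ha' g hg, hb' g hg]
    group
  one_mem' := ⟨D.one_mem, fun g _ => by group⟩
  inv_mem' := by
    rintro a ⟨ha, ha'⟩
    refine ⟨D.inv_mem ha, fun g hg => ?_⟩
    have e : a⁻¹ * g * a⁻¹⁻¹ * g⁻¹ = a⁻¹ * (a * g * a⁻¹ * g⁻¹)⁻¹ * a := by group
    rw [e, ha' g hg]
    group

/-- The countable stabilizer groups: isotropy `Γ_x`, and `g` in the stabilizer of `U n`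
in `Γ`. -/
def countableStab {Γ : Type w} [Group Γ] {X : Type u} [TopologicalSpace X]
    (Φ : Γ →* (X ≃ₜ X)) {x : X} (B : AdaptedBasis Φ x) (n : ℕ) : Subgroup (X ≃ₜ X) :=
  stabilizerSubgroup (pointStabilizer Φ.range x) (returnTimes Φ (B.U n))

/-- The countable centralizer groups. -/
def countableCent {Γ : Type w} [Group Γ] {X : Type u} [TopologicalSpace X]
    (Φ : Γ →* (X ≃ₜ X)) {x : X} (B : AdaptedBasis Φ x) (n : ℕ) : Subgroup (X ≃ₜ X) :=
  centralizerSubgroup (pointStabilizer Φ.range x) (returnTimes Φ (B.U n))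

/-- The (profinite) stabilizer groups: isotropy of the Ellis group at `x`, and `g` in the closure
of the stabilizer of `U n` in `Γ`. -/
def profiniteStab {Γ : Type w} [Group Γ] {X : Type u} [MetricSpace X]
    (Φ : Γ →* (X ≃ₜ X)) (hΦ : IsEquicontinuous Φ) {x : X} (B : AdaptedBasis Φ x) (n : ℕ) :
    Subgroup (X ≃ₜ X) :=
  stabilizerSubgroup (pointStabilizer (ellisGroup Φ hΦ) x)
    (pointwiseClosure (returnTimes Φ (B.U n)))

/-- The (profinite) centralizer groups. -/
def profiniteCent {Γ : Type w} [Group Γ] {X : Type u} [MetricSpace X]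
    (Φ : Γ →* (X ≃ₜ X)) (hΦ : IsEquicontinuous Φ) {x : X} (B : AdaptedBasis Φ x) (n : ℕ) :
    Subgroup (X ≃ₜ X) :=
  centralizerSubgroup (pointStabilizer (ellisGroup Φ hΦ) x)
    (pointwiseClosure (returnTimes Φ (B.U n)))

/-! ### Types of chains

The direct limit of an increasing chain of subgroups along the inclusions is its union
`⨆ n, K n`. -/

/-- The direct limit of the chain `K` is bounded: from some index on, all inclusions
`K m → K n` are isomorphisms. -/
def IsBoundedChain {A : Type u} [Group A] (K : ℕ → Subgroup A) : Prop :=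
  ∃ k : ℕ, ∀ m n : ℕ, k ≤ m → m ≤ n → K m = K n

/-- Unbounded, and all groups of the chain are finite. -/
def IsFiniteType {A : Type u} [Group A] (K : ℕ → Subgroup A) : Prop :=
  ¬ IsBoundedChain K ∧ ∀ n, Finite (K n)

/-- Unbounded, and the inclusion of the direct limit of the centralizer groups into that of the
stabilizer groups is onto. -/
def IsFlatType {A : Type u} [Group A] (Z K : ℕ → Subgroup A) : Prop :=
  ¬ IsBoundedChain K ∧ (⨆ n, Z n) = ⨆ n, K n

/-- Unbounded, and the inclusion of the direct limits is proper. -/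
def IsDynamicType {A : Type u} [Group A] (Z K : ℕ → Subgroup A) : Prop :=
  ¬ IsBoundedChain K ∧ (⨆ n, Z n) ≠ ⨆ n, K n

/-! ### The six classes of actions

Each class is first defined with respect to a given adapted neighbourhood basis at a point, and
then for the action, by the existence of such a basis. -/

section Countable

variable {Γ : Type w} [Group Γ] {X : Type u} [MetricSpace X] (Φ : Γ →* (X ≃ₜ X))

def CountablyWildFiniteAt {x : X} (B : AdaptedBasis Φ x) : Prop :=
  ¬ IsLQA Φ ∧ IsFiniteType (countableStab Φ B)

def CountablyWildFlatAt {x : X} (B : AdaptedBasis Φ x) : Prop :=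
  ¬ IsLQA Φ ∧ IsFlatType (countableCent Φ B) (countableStab Φ B)

def CountablyDynamicallyWildAt {x : X} (B : AdaptedBasis Φ x) : Prop :=
  ¬ IsLQA Φ ∧ IsDynamicType (countableCent Φ B) (countableStab Φ B)

/-- Countably wild of finite type. -/
def CountablyWildFinite : Prop :=
  ∃ (x : X) (B : AdaptedBasis Φ x), CountablyWildFiniteAt Φ B

/-- Countably wild of flat type. -/
def CountablyWildFlat : Prop :=
  ∃ (x : X) (B : AdaptedBasis Φ x), CountablyWildFlatAt Φ B

/-- Countably dynamically wild. -/
def CountablyDynamicallyWild : Prop :=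
  ∃ (x : X) (B : AdaptedBasis Φ x), CountablyDynamicallyWildAt Φ B

end Countable

section Profinite

variable {Γ : Type w} [Group Γ] {X : Type u} [MetricSpace X] (Φ : Γ →* (X ≃ₜ X))
  (hΦ : IsEquicontinuous Φ)

def WildFiniteAt {x : X} (B : AdaptedBasis Φ x) : Prop :=
  IsWild Φ hΦ ∧ IsFiniteType (profiniteStab Φ hΦ B)

def WildFlatAt {x : X} (B : AdaptedBasis Φ x) : Prop :=
  IsWild Φ hΦ ∧ IsFlatType (profiniteCent Φ hΦ B) (profiniteStab Φ hΦ B)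

def DynamicallyWildAt {x : X} (B : AdaptedBasis Φ x) : Prop :=
  IsWild Φ hΦ ∧ IsDynamicType (profiniteCent Φ hΦ B) (profiniteStab Φ hΦ B)

/-- Wild of finite type. -/
def WildFinite : Prop :=
  ∃ (x : X) (B : AdaptedBasis Φ x), WildFiniteAt Φ hΦ B

/-- Wild of flat type. -/
def WildFlat : Prop :=
  ∃ (x : X) (B : AdaptedBasis Φ x), WildFlatAt Φ hΦ B

/-- Dynamically wild. -/
def DynamicallyWild : Prop :=
  ∃ (x : X) (B : AdaptedBasis Φ x), DynamicallyWildAt Φ hΦ B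

end Profinite

end CantorAction

/-!
The isotropy elements `h` at `x` with `[h, g] x = x` for all return times `g` to an adapted set `U`
are those that fix the orbit of `x` under these return times. By minimality this orbit is dense
in `U`, so the stabilizer groups, countable or profinite, are the *fixators* of the sets `U n`: the
elements of a group `D` of homeomorphisms, either `Φ(Γ)` or the Ellis group, that are the identity
on `U n`. The centralizer groups consist of the elements of the fixator that commute with the return
times to `U n`. After that, `D` can be any group of homeomorphisms that contains `Φ(Γ)`.

Each condition in the definition of the six classes then has a form that involves neither `x` nor
the neighbourhood basis:
* boundedness of the chain, like local quasi-analyticity, says that some adapted set is rigid, that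
  is, that an element which is the identity on a smaller adapted set is the identity on all of it
  (`isBoundedChain_fixator_iff`, `isLQA_iff_isRigidOn`);
* finiteness of the groups says that the fixators of all adapted sets are finite
  (`finite_fixator_iff`);
* equality of the limits says that an element which is the identity near `y` commutes with the
  return times to some adapted neighbourhood of `y`, for every `y` (`iSup_centralFixator_eq_iff`).

The last equivalence rests on the fact that the orbit of `y` under a subgroup of finite index is
dense in a neighbourhood of `y` (`closure_orbit_mem_nhds`). It is applied to the subgroup of elements
that commute with a given `h`, which has finite index as soon as `h` commutes with the return times
to one adapted set. The same fact shows that a non-Hausdorff element `g` excludes flatness: an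
element commuting with `g` would carry an open set on which `g` is the identity to a neighbourhood of
the point.

The three conditions are preserved by conjugacy, and pass from the Ellis group to its subgroup
`Φ(Γ)`, which gives the comparison between the profinite and the countable classes. Finally, two
germs at `x` that cannot be separated come from elements `g₁`, `g₂` such that `g₂⁻¹ g₁` is
non-Hausdorff at `x`.
-/

namespace CantorAction

/-! ### Adapted sets -/

section Adapted

variable {Γ : Type w} [Group Γ] {X : Type u} [TopologicalSpace X] {Φ : Γ →* (X ≃ₜ X)}

theorem action_mul_apply (Φ : Γ →* (X ≃ₜ X)) (γ δ : Γ) (x : X) :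
    Φ (γ * δ) x = Φ γ (Φ δ x) := by
  rw [map_mul, Homeomorph.mul_apply]

@[simp]
theorem action_inv_apply_self (Φ : Γ →* (X ≃ₜ X)) (γ : Γ) (x : X) : Φ γ⁻¹ (Φ γ x) = x := by
  rw [map_inv, Homeomorph.inv_apply, Homeomorph.symm_apply_apply]

@[simp]
theorem action_apply_inv_self (Φ : Γ →* (X ≃ₜ X)) (γ : Γ) (x : X) : Φ γ (Φ γ⁻¹ x) = x := by
  rw [map_inv, Homeomorph.inv_apply, Homeomorph.apply_symm_apply]

theorem mem_action_image_iff (Φ : Γ →* (X ≃ₜ X)) (γ : Γ) {U : Set X} {x : X} :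
    x ∈ Φ γ '' U ↔ Φ γ⁻¹ x ∈ U := by
  constructor
  · rintro ⟨y, hy, rfl⟩
    rwa [action_inv_apply_self]
  · exact fun h => ⟨_, h, action_apply_inv_self Φ γ x⟩

theorem action_image_mul (Φ : Γ →* (X ≃ₜ X)) (γ δ : Γ) (U : Set X) :
    Φ (γ * δ) '' U = Φ γ '' (Φ δ '' U) := by
  rw [image_image]
  exact image_congr fun x _ => action_mul_apply Φ γ δ x

theorem IsMinimal.exists_mem (hmin : IsMinimal Φ) (x : X) {O : Set X} (hO : IsOpen O)
    (hne : O.Nonempty) : ∃ γ : Γ, Φ γ x ∈ O := by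
  obtain ⟨_, ⟨γ, rfl⟩, h⟩ := (hmin x).exists_mem_open hO hne
  exact ⟨γ, h⟩

theorem IsAdapted.image_eq {U : Set X} (hU : IsAdapted Φ U) {γ : Γ} {x : X} (hx : x ∈ U)
    (hγ : Φ γ x ∈ U) : Φ γ '' U = U :=
  (hU.2.2 γ).resolve_right fun h => disjoint_left.1 h (mem_image_of_mem _ hx) hγ

theorem IsAdapted.apply_mem {U : Set X} (hU : IsAdapted Φ U) {γ : Γ} {x y : X} (hx : x ∈ U)
    (hγ : Φ γ x ∈ U) (hy : y ∈ U) : Φ γ y ∈ U :=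
  hU.image_eq hx hγ ▸ mem_image_of_mem _ hy

theorem IsAdapted.image {U : Set X} (hU : IsAdapted Φ U) (γ : Γ) : IsAdapted Φ (Φ γ '' U) := by
  refine ⟨⟨(Φ γ).isClosed_image.2 hU.1.1, (Φ γ).isOpen_image.2 hU.1.2⟩, hU.2.1.image _,
    fun δ => ?_⟩
  have key : Φ δ '' (Φ γ '' U) = Φ γ '' (Φ (γ⁻¹ * δ * γ) '' U) := by
    rw [← action_image_mul, ← action_image_mul]
    congr 2
    group
  rw [key]
  rcases hU.2.2 (γ⁻¹ * δ * γ) with h | h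
  · exact Or.inl (by rw [h])
  · exact Or.inr ((disjoint_image_iff (Φ γ).injective).2 h)

theorem IsAdapted.inter {U V : Set X} (hU : IsAdapted Φ U) (hV : IsAdapted Φ V)
    (hne : (U ∩ V).Nonempty) : IsAdapted Φ (U ∩ V) := by
  refine ⟨hU.1.inter hV.1, hne, fun γ => or_iff_not_imp_right.2 fun h => ?_⟩
  obtain ⟨_, ⟨x, hx, rfl⟩, hγ⟩ := not_disjoint_iff.1 h
  rw [image_inter (Φ γ).injective, hU.image_eq hx.1 hγ.1, hV.image_eq hx.2 hγ.2]

theorem isAdapted_univ [Nonempty X] : IsAdapted Φ (univ : Set X) :=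
  ⟨isClopen_univ, univ_nonempty, fun γ => Or.inl (image_univ_of_surjective (Φ γ).surjective)⟩

theorem AdaptedBasis.antitone {x : X} (B : AdaptedBasis Φ x) : Antitone B.U :=
  antitone_nat_of_succ_le fun n => (B.ssubset n).subset

theorem AdaptedBasis.exists_subset [CompactSpace X] {x : X} (B : AdaptedBasis Φ x) {W : Set X}
    (hW : W ∈ 𝓝 x) : ∃ n, B.U n ⊆ W := by
  refine exists_subset_nhds_of_compactSpace B.antitone.directed_ge
    (fun n => (B.adapted n).1.1) fun y hy => ?_
  rw [B.iInter] at hy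
  rwa [mem_singleton_iff.1 hy]

theorem AdaptedBasis.exists_image_subset [CompactSpace X] {x : X} (B : AdaptedBasis Φ x) (γ : Γ)
    {W : Set X} (hW : W ∈ 𝓝 (Φ γ x)) : ∃ n, Φ γ '' B.U n ⊆ W := by
  obtain ⟨n, hn⟩ := B.exists_subset ((Φ γ).continuous.continuousAt hW)
  exact ⟨n, image_subset_iff.2 hn⟩

/-- In an equicontinuous action, the level sets of the map `y ↦ {γ | γ y ∈ W}`, for `W` clopen,
are adapted. -/
theorem exists_isAdapted_subset {X : Type u} [MetricSpace X] [CompactSpace X]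
    [TotallyDisconnectedSpace X] {Φ : Γ →* (X ≃ₜ X)} (hequi : IsEquicontinuous Φ) {x : X}
    {O : Set X} (hO : O ∈ 𝓝 x) : ∃ U, IsAdapted Φ U ∧ x ∈ U ∧ U ⊆ O := by
  obtain ⟨O', hO'O, hO', hx⟩ := mem_nhds_iff.1 hO
  obtain ⟨W, hW, hxW, hWO⟩ := compact_exists_isClopen_in_isOpen hO' hx
  obtain ⟨ε, hε, hWε⟩ : ∃ ε > 0, ∀ y z : X, dist y z < ε → (y ∈ W ↔ z ∈ W) := by
    obtain ⟨ε, hε, h⟩ := lebesgue_number_lemma_of_metric (c := fun b : Bool => bif b then W else Wᶜ)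
      (isCompact_univ (X := X)) (by rintro (_ | _); exacts [hW.compl.2, hW.2])
      (fun y _ => mem_iUnion.2 (by
        by_cases hy : y ∈ W
        exacts [⟨true, hy⟩, ⟨false, hy⟩]))
    refine ⟨ε, hε, fun y z hyz => ?_⟩
    obtain ⟨b, hb⟩ := h y (mem_univ y)
    have hy := hb (Metric.mem_ball_self hε)
    have hz := hb (show z ∈ Metric.ball y ε by rwa [Metric.mem_ball, dist_comm])
    cases b
    · exact iff_of_false hy hz
    · exact iff_of_true hy hz
  obtain ⟨δ, hδ, hδε⟩ := hequi ε hε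
  have hstep : ∀ y z : X, dist y z < δ → ∀ γ, (Φ γ y ∈ W ↔ Φ γ z ∈ W) := fun y z h γ =>
    hWε _ _ (hδε γ y z h)
  refine ⟨{y | ∀ γ, Φ γ y ∈ W ↔ Φ γ x ∈ W}, ⟨⟨?_, ?_⟩, ⟨x, fun _ => Iff.rfl⟩, fun γ => ?_⟩,
    fun _ => Iff.rfl, fun y hy => ?_⟩
  · rw [← isOpen_compl_iff, Metric.isOpen_iff]
    refine fun y hy => ⟨δ, hδ, fun z hz hz' => hy fun γ => ?_⟩
    exact (hstep z y hz γ).symm.trans (hz' γ)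
  · rw [Metric.isOpen_iff]
    exact fun y hy => ⟨δ, hδ, fun z hz γ => (hstep z y hz γ).trans (hy γ)⟩
  · refine or_iff_not_imp_right.2 fun h => ?_
    obtain ⟨_, ⟨y, hy, rfl⟩, hγ⟩ := not_disjoint_iff.1 h
    ext z
    rw [mem_action_image_iff]
    -- `y` and `γ y` have the same return times to `W` as `x`, so `γ` preserves the level set.
    have key : ∀ δ, (Φ (δ * γ⁻¹) x ∈ W ↔ Φ δ x ∈ W) := fun δ => by
      have h1 := hγ (δ * γ⁻¹)
      rw [← action_mul_apply, inv_mul_cancel_right] at h1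
      exact h1.symm.trans (hy δ)
    constructor
    · intro hz δ
      have h1 := hz (δ * γ)
      rw [← action_mul_apply, mul_inv_cancel_right] at h1
      rw [h1, ← key, mul_inv_cancel_right]
    · intro hz δ
      rw [← action_mul_apply, hz, key]
  · have h := (hy 1).2
    rw [map_one] at h
    exact hO'O (hWO (h hxW))

theorem nonempty_adaptedBasis {X : Type u} [MetricSpace X] [CompactSpace X]
    [TotallyDisconnectedSpace X] [PerfectSpace X] {Φ : Γ →* (X ≃ₜ X)}
    (hequi : IsEquicontinuous Φ) (x : X) : Nonempty (AdaptedBasis Φ x) := by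
  have step : ∀ (V : {V : Set X // IsAdapted Φ V ∧ x ∈ V}) (n : ℕ),
      ∃ U : {V : Set X // IsAdapted Φ V ∧ x ∈ V},
        U.1 ⊂ V.1 ∧ U.1 ⊆ Metric.ball x (1 / ((n : ℝ) + 1)) := by
    rintro ⟨V, hV, hxV⟩ n
    have hVx : V ∈ 𝓝 x := hV.1.2.mem_nhds hxV
    obtain ⟨z, ⟨hzV, -⟩, hzx⟩ :=
      accPt_iff_nhds.1 (PerfectSpace.univ_preperfect x (mem_univ x)) V hVx
    obtain ⟨U, hU, hxU, hUV⟩ := exists_isAdapted_subset hequi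
      (inter_mem (inter_mem hVx (isOpen_compl_singleton.mem_nhds hzx.symm))
        (Metric.ball_mem_nhds x (Nat.one_div_pos_of_nat (n := n))))
    exact ⟨⟨U, hU, hxU⟩, ⟨fun y hy => (hUV hy).1.1, fun h => (hUV (h hzV)).1.2 rfl⟩,
      fun y hy => (hUV hy).2⟩
  choose next hss hball using step
  let U : ℕ → {V : Set X // IsAdapted Φ V ∧ x ∈ V} := fun n =>
    Nat.rec ⟨univ, @isAdapted_univ _ _ _ _ _ ⟨x⟩, mem_univ x⟩ (fun n V => next V n) n
  refine ⟨⟨fun n => (U n).1, rfl, fun n => (U n).2.1, fun n => (U n).2.2,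
    fun n => hss (U n) n, ?_⟩⟩
  refine Subset.antisymm (fun y hy => ?_)
    (singleton_subset_iff.2 (mem_iInter.2 fun n => (U n).2.2))
  by_contra hyx
  obtain ⟨n, hn⟩ := exists_nat_one_div_lt (dist_pos.2 hyx)
  exact lt_asymm hn (hball (U n) n (mem_iInter.1 hy (n + 1)))

end Adapted

/-! ### Recurrence under subgroups of finite index -/

section FiniteIndex

variable {Γ : Type w} [Group Γ] {X : Type u} [TopologicalSpace X] [CompactSpace X]
  {Φ : Γ →* (X ≃ₜ X)}

/-- The return times to an adapted set have finite index, because finitely many translates of the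
set cover the space. -/
theorem finiteIndex_of_returnTimes (hmin : IsMinimal Φ) {W : Set X} (hW : IsAdapted Φ W)
    {H : Subgroup Γ} (hH : ∀ γ, Φ γ ∈ returnTimes Φ W → γ ∈ H) : H.FiniteIndex := by
  obtain ⟨t, ht⟩ := isCompact_univ.elim_finite_subcover (fun γ : Γ => Φ γ '' W)
    (fun γ => (hW.image γ).1.2) (fun y _ => mem_iUnion.2 (by
      obtain ⟨γ, hγ⟩ := hmin.exists_mem y hW.1.2 hW.2.1
      exact ⟨γ⁻¹, by rwa [mem_action_image_iff, inv_inv]⟩))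
  have : Finite (Γ ⧸ H) := by
    refine Finite.of_surjective (fun γ : t => (γ.1 : Γ ⧸ H)) fun q => ?_
    obtain ⟨δ, rfl⟩ := QuotientGroup.mk_surjective q
    obtain ⟨w, hw⟩ := hW.2.1
    obtain ⟨γ, hγt, hγ⟩ := mem_iUnion₂.1 (ht (mem_univ (Φ δ w)))
    refine ⟨⟨γ, hγt⟩, QuotientGroup.eq.2 (hH _ ⟨⟨_, rfl⟩, Φ (γ⁻¹ * δ) w, ⟨w, hw, rfl⟩, ?_⟩)⟩
    rw [action_mul_apply]
    exact (mem_action_image_iff Φ γ).1 hγ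
  exact Subgroup.finiteIndex_of_finite_quotient

/-- The orbit of a point under a subgroup of finite index of a minimal action is dense in a
neighbourhood of the point. -/
theorem closure_orbit_mem_nhds [T2Space X] (hmin : IsMinimal Φ) (H : Subgroup Γ)
    [H.FiniteIndex] (y : X) : closure ((fun γ => Φ γ y) '' (H : Set Γ)) ∈ 𝓝 y := by
  set A : Set X := (fun γ => Φ γ y) '' (H : Set Γ) with hA
  have : Nonempty X := ⟨y⟩
  -- The closures of the orbits along the finitely many cosets cover the space.
  have hcov : ⋃ q : Γ ⧸ H, closure (Φ q.out '' A) = univ := by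
    rw [← closure_iUnion_of_finite, ← dense_iff_closure_eq]
    refine (hmin y).mono ?_
    rintro _ ⟨γ, rfl⟩
    refine mem_iUnion.2 ⟨(γ : Γ ⧸ H), Φ ((γ : Γ ⧸ H).out⁻¹ * γ) y,
      mem_image_of_mem _ (QuotientGroup.eq.1 (QuotientGroup.out_eq' (γ : Γ ⧸ H))), ?_⟩
    rw [← action_mul_apply, mul_inv_cancel_left]
  obtain ⟨q, hq⟩ := nonempty_interior_of_iUnion_of_closed (fun _ => isClosed_closure) hcov
  rw [← (Φ q.out).image_closure, ← (Φ q.out).image_interior, image_nonempty] at hq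
  obtain ⟨z, hz⟩ := hq
  obtain ⟨_, hi, γ, hγ, rfl⟩ := mem_closure_iff.1 (interior_subset hz) _ isOpen_interior hz
  -- The closure of `H y` is invariant under `H`.
  have hinv : closure A ⊆ Φ γ ⁻¹' closure A := by
    refine closure_minimal ?_ (isClosed_closure.preimage (Φ γ).continuous)
    rintro _ ⟨δ, hδ, rfl⟩
    exact subset_closure ⟨γ * δ, H.mul_mem hγ hδ, action_mul_apply Φ γ δ y⟩
  have hinv' : Φ γ ⁻¹' closure A ⊆ closure A := by
    rw [(Φ γ).preimage_closure]
    refine closure_mono ?_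
    rintro z ⟨δ, hδ, hz⟩
    refine ⟨γ⁻¹ * δ, H.mul_mem (H.inv_mem hγ) hδ, ?_⟩
    change Φ δ y = Φ γ z at hz
    change Φ (γ⁻¹ * δ) y = z
    rw [action_mul_apply, hz, action_inv_apply_self]
  exact mem_of_superset ((Φ γ).continuous.continuousAt
    (mem_interior_iff_mem_nhds.1 hi)) hinv'

end FiniteIndex

/-! ### Fixators of adapted sets -/

section Fixator

variable {Γ : Type w} [Group Γ] {X : Type u} [TopologicalSpace X] {Φ : Γ →* (X ≃ₜ X)}

/-- The elements of a group `D` of homeomorphisms that are the identity on `U`. -/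
def fixator (D : Subgroup (X ≃ₜ X)) (U : Set X) : Subgroup (X ≃ₜ X) where
  carrier := {φ | φ ∈ D ∧ EqOn φ id U}
  mul_mem' := by
    rintro a b ⟨ha, ha'⟩ ⟨hb, hb'⟩
    refine ⟨D.mul_mem ha hb, fun z hz => ?_⟩
    rw [Homeomorph.mul_apply, hb' hz, id, ha' hz, id]
  one_mem' := ⟨D.one_mem, fun _ _ => rfl⟩
  inv_mem' := by
    rintro a ⟨ha, ha'⟩
    refine ⟨D.inv_mem ha, fun z hz => ?_⟩
    rw [Homeomorph.inv_apply, Homeomorph.symm_apply_eq]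
    exact (ha' hz).symm

/-- The elements of the fixator of `U` that commute with the return times of the action to `U`. -/
def centralFixator (Φ : Γ →* (X ≃ₜ X)) (D : Subgroup (X ≃ₜ X)) (U : Set X) :
    Subgroup (X ≃ₜ X) :=
  fixator D U ⊓ Subgroup.centralizer (returnTimes Φ U)

theorem fixator_anti (D : Subgroup (X ≃ₜ X)) {U V : Set X} (h : V ⊆ U) :
    fixator D U ≤ fixator D V :=
  fun _ hφ => ⟨hφ.1, hφ.2.mono h⟩

theorem returnTimes_mono {U V : Set X} (h : V ⊆ U) : returnTimes Φ V ⊆ returnTimes Φ U :=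
  fun _ hφ => ⟨hφ.1, hφ.2.mono (inter_subset_inter (image_mono h) h)⟩

theorem centralFixator_anti (D : Subgroup (X ≃ₜ X)) {U V : Set X} (h : V ⊆ U) :
    centralFixator Φ D U ≤ centralFixator Φ D V :=
  inf_le_inf (fixator_anti D h) (Subgroup.centralizer_le (returnTimes_mono h))

theorem conj_mem_fixator_image {D : Subgroup (X ≃ₜ X)} (hD : Φ.range ≤ D) (γ : Γ) {U : Set X}
    {φ : X ≃ₜ X} (hφ : φ ∈ fixator D U) : Φ γ * φ * (Φ γ)⁻¹ ∈ fixator D (Φ γ '' U) := by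
  refine ⟨D.mul_mem (D.mul_mem (hD ⟨γ, rfl⟩) hφ.1) (D.inv_mem (hD ⟨γ, rfl⟩)), ?_⟩
  rintro _ ⟨z, hz, rfl⟩
  rw [Homeomorph.mul_apply, Homeomorph.mul_apply, Homeomorph.inv_apply,
    Homeomorph.symm_apply_apply, hφ.2 hz]
  rfl

theorem conj_mem_centralizer_image (γ : Γ) {U : Set X} {φ : X ≃ₜ X}
    (hφ : φ ∈ Subgroup.centralizer (returnTimes Φ U)) :
    Φ γ * φ * (Φ γ)⁻¹ ∈ Subgroup.centralizer (returnTimes Φ (Φ γ '' U)) := by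
  rw [Subgroup.mem_centralizer_iff] at hφ ⊢
  rintro _ ⟨⟨δ, rfl⟩, _, ⟨_, ⟨z, hz, rfl⟩, rfl⟩, hδ⟩
  have h := hφ (Φ (γ⁻¹ * δ * γ)) ⟨⟨_, rfl⟩, _, mem_image_of_mem _ hz, by
    rw [action_mul_apply, action_mul_apply]
    exact (mem_action_image_iff Φ γ).1 hδ⟩
  rw [map_mul, map_mul, map_inv] at h
  calc Φ δ * (Φ γ * φ * (Φ γ)⁻¹)
      = Φ γ * ((Φ γ)⁻¹ * Φ δ * Φ γ * φ) * (Φ γ)⁻¹ := by group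
    _ = Φ γ * φ * (Φ γ)⁻¹ * Φ δ := by rw [h]; group

theorem mem_fixator_image_iff {D : Subgroup (X ≃ₜ X)} (hD : Φ.range ≤ D) (γ : Γ) {U : Set X}
    {φ : X ≃ₜ X} : φ ∈ fixator D (Φ γ '' U) ↔ (Φ γ)⁻¹ * φ * Φ γ ∈ fixator D U := by
  constructor
  · intro h
    have h' := conj_mem_fixator_image hD γ⁻¹ h
    rwa [← action_image_mul, inv_mul_cancel, map_one, map_inv, inv_inv,
      show ((1 : X ≃ₜ X) : X → X) '' U = U from image_id U] at h'
  · intro h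
    have h' := conj_mem_fixator_image hD γ h
    rwa [show Φ γ * ((Φ γ)⁻¹ * φ * Φ γ) * (Φ γ)⁻¹ = φ by group] at h'

/-! ### The stabilizer and centralizer chains as fixators -/

theorem returnTimes_subset_range (U : Set X) : returnTimes Φ U ⊆ Φ.range := fun _ h => h.1

/-- An isotropy element `h` at `x` satisfies `[h, g] x = x` exactly if it fixes `g⁻¹ x`, so the
stabilizer group is the pointwise stabilizer of an orbit, which is dense in `U`. -/
theorem stabilizerSubgroup_eq_fixator [T2Space X] (hmin : IsMinimal Φ) {D : Subgroup (X ≃ₜ X)}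
    {U : Set X} (hU : IsAdapted Φ U) {x : X} (hx : x ∈ U) {H : Set (X ≃ₜ X)} (hH : returnTimes Φ U ⊆ H) (hHD : H ⊆ D)
    (hHU : ∀ g ∈ H, g⁻¹ x ∈ U) :
    stabilizerSubgroup (pointStabilizer D x) H = fixator D U := by
  ext h
  constructor
  · rintro ⟨⟨hhD, hhx⟩, hcomm⟩
    refine ⟨hhD, ?_⟩
    have hfix : ∀ γ : Γ, Φ γ x ∈ U → h (Φ γ x) = Φ γ x := by
      intro γ hγ
      have h1 : Φ γ⁻¹ ∈ returnTimes Φ U :=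
        ⟨⟨_, rfl⟩, x, ⟨_, hγ, action_inv_apply_self Φ γ x⟩, hx⟩
      have h2 := (hcomm _ (hH h1)).2
      rw [← map_inv, inv_inv] at h2
      simp only [Homeomorph.mul_apply] at h2
      -- `h g h⁻¹ g⁻¹ x = x = h x` gives `h⁻¹ g⁻¹ x = g⁻¹ x`.
      have h3 : Φ γ⁻¹ (h⁻¹ (Φ γ x)) = x := h.injective (h2.trans hhx.symm)
      have h4 : h⁻¹ (Φ γ x) = Φ γ x := by
        rw [← action_apply_inv_self Φ γ (h⁻¹ (Φ γ x)), h3]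
      rw [Homeomorph.inv_apply, Homeomorph.symm_apply_eq] at h4
      exact h4.symm
    intro z hz
    have hcl : IsClosed {z | h z = z} := isClosed_eq h.continuous continuous_id
    by_contra hne
    obtain ⟨γ, hγ⟩ := hmin.exists_mem x (hU.1.2.inter hcl.isOpen_compl) ⟨z, hz, hne⟩
    exact hγ.2 (hfix γ hγ.1)
  · rintro ⟨hhD, hhU⟩
    refine ⟨⟨hhD, hhU hx⟩, fun g hg => ⟨?_, ?_⟩⟩
    · exact D.mul_mem (D.mul_mem (D.mul_mem hhD (hHD hg)) (D.inv_mem hhD)) (D.inv_mem (hHD hg))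
    · have h1 : h⁻¹ (g⁻¹ x) = g⁻¹ x := by
        rw [Homeomorph.inv_apply, Homeomorph.symm_apply_eq]
        exact (hhU (hHU g hg)).symm
      simp only [Homeomorph.mul_apply]
      rw [h1, ← Homeomorph.mul_apply g, mul_inv_cancel]
      exact hhU hx

theorem mul_inv_mul_inv_eq_one_iff {A : Type*} [Group A] (h g : A) :
    h * g * h⁻¹ * g⁻¹ = 1 ↔ g * h = h * g := by
  rw [mul_inv_eq_one, mul_inv_eq_iff_eq_mul, eq_comm]

/-- Commuting with a set of homeomorphisms implies commuting with its pointwise closure. -/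
theorem mul_eq_mul_of_mem_pointwiseClosure [T2Space X] {h g : X ≃ₜ X} {S : Set (X ≃ₜ X)}
    (hS : ∀ s ∈ S, s * h = h * s) (hg : g ∈ pointwiseClosure S) : g * h = h * g := by
  have hcl : IsClosed {f : X → X | ∀ z, f (h z) = h (f z)} := by
    simp only [ofPred_forall]
    exact isClosed_iInter fun z =>
      isClosed_eq (continuous_apply _) (h.continuous.comp (continuous_apply z))
  have := closure_minimal (t := {f : X → X | ∀ z, f (h z) = h (f z)}) (by
    rintro _ ⟨s, hs, rfl⟩ z
    exact DFunLike.congr_fun (hS s hs) z) hcl hg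
  ext z
  exact this z

theorem centralizerSubgroup_eq_centralFixator [T2Space X] (hmin : IsMinimal Φ)
    {D : Subgroup (X ≃ₜ X)} {U : Set X} (hU : IsAdapted Φ U) {x : X} (hx : x ∈ U) {H : Set (X ≃ₜ X)} (hH : returnTimes Φ U ⊆ H) (hHD : H ⊆ D)
    (hHU : ∀ g ∈ H, g⁻¹ x ∈ U) (hHcl : H ⊆ pointwiseClosure (returnTimes Φ U)) :
    centralizerSubgroup (pointStabilizer D x) H = centralFixator Φ D U := by
  have hfix := stabilizerSubgroup_eq_fixator hmin hU hx hH hHD hHU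
  ext h
  constructor
  · rintro ⟨hhD, hcomm⟩
    refine ⟨hfix ▸ ⟨hhD, fun g hg => ?_⟩, Subgroup.mem_centralizer_iff.2 fun g hg =>
      (mul_inv_mul_inv_eq_one_iff h g).1 (hcomm g (hH hg))⟩
    rw [hcomm g hg]
    exact one_mem _
  · rintro ⟨hhU, hcomm⟩
    refine ⟨⟨hhU.1, hhU.2 hx⟩, fun g hg => (mul_inv_mul_inv_eq_one_iff h g).2 ?_⟩
    exact mul_eq_mul_of_mem_pointwiseClosure (Subgroup.mem_centralizer_iff.1 hcomm) (hHcl hg)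

theorem IsAdapted.inv_apply_mem_of_mem_pointwiseClosure {U : Set X} (hU : IsAdapted Φ U)
    {g : X ≃ₜ X} (hg : g ∈ pointwiseClosure (returnTimes Φ U)) {x : X} (hx : x ∈ U) :
    g⁻¹ x ∈ U := by
  have hopen : IsOpen {f : X → X | f (g⁻¹ x) ∈ U} := hU.1.2.preimage (continuous_apply _)
  obtain ⟨_, hf, _, ⟨⟨γ, rfl⟩, _, ⟨z, hz, rfl⟩, hγz⟩, rfl⟩ := mem_closure_iff.1 hg _ hopen (by
    change g (g⁻¹ x) ∈ U
    rwa [Homeomorph.inv_apply, Homeomorph.apply_symm_apply])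
  have := hU.apply_mem (γ := γ⁻¹) hγz (by rwa [action_inv_apply_self]) hf
  rwa [action_inv_apply_self] at this

theorem countableStab_eq_fixator [T2Space X] (hmin : IsMinimal Φ) {x : X}
    (B : AdaptedBasis Φ x) (n : ℕ) : countableStab Φ B n = fixator Φ.range (B.U n) :=
  stabilizerSubgroup_eq_fixator hmin (B.adapted n) (B.mem n) Subset.rfl
    (returnTimes_subset_range _) fun _ hg =>
      (B.adapted n).inv_apply_mem_of_mem_pointwiseClosure (subset_pointwiseClosure _ hg) (B.mem n)

theorem countableCent_eq_centralFixator [T2Space X] (hmin : IsMinimal Φ) {x : X}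
    (B : AdaptedBasis Φ x) (n : ℕ) :
    countableCent Φ B n = centralFixator Φ Φ.range (B.U n) :=
  centralizerSubgroup_eq_centralFixator hmin (B.adapted n) (B.mem n) Subset.rfl
    (returnTimes_subset_range _) (fun _ hg =>
      (B.adapted n).inv_apply_mem_of_mem_pointwiseClosure (subset_pointwiseClosure _ hg) (B.mem n))
    (subset_pointwiseClosure _)

end Fixator

section Ellis

variable {Γ : Type w} [Group Γ] {X : Type u} [MetricSpace X] {Φ : Γ →* (X ≃ₜ X)}

theorem range_le_ellisGroup (hequi : IsEquicontinuous Φ) : Φ.range ≤ ellisGroup Φ hequi :=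
  fun _ h => subset_pointwiseClosure _ h

theorem pointwiseClosure_returnTimes_subset (hequi : IsEquicontinuous Φ) (U : Set X) :
    pointwiseClosure (returnTimes Φ U) ⊆ ellisGroup Φ hequi :=
  fun _ h => closure_mono (image_mono (returnTimes_subset_range U)) h

theorem profiniteStab_eq_fixator (hmin : IsMinimal Φ) (hequi : IsEquicontinuous Φ) {x : X}
    (B : AdaptedBasis Φ x) (n : ℕ) :
    profiniteStab Φ hequi B n = fixator (ellisGroup Φ hequi) (B.U n) :=
  stabilizerSubgroup_eq_fixator hmin (B.adapted n) (B.mem n)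
    (subset_pointwiseClosure _) (pointwiseClosure_returnTimes_subset hequi _) fun _ hg =>
      (B.adapted n).inv_apply_mem_of_mem_pointwiseClosure hg (B.mem n)

theorem profiniteCent_eq_centralFixator (hmin : IsMinimal Φ) (hequi : IsEquicontinuous Φ) {x : X}
    (B : AdaptedBasis Φ x) (n : ℕ) :
    profiniteCent Φ hequi B n = centralFixator Φ (ellisGroup Φ hequi) (B.U n) :=
  centralizerSubgroup_eq_centralFixator hmin (B.adapted n) (B.mem n)
    (subset_pointwiseClosure _) (pointwiseClosure_returnTimes_subset hequi _) (fun _ hg =>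
      (B.adapted n).inv_apply_mem_of_mem_pointwiseClosure hg (B.mem n)) Subset.rfl

/-- The Ellis group has the same adapted sets as the action itself, since membership in a clopen
set is locally constant for pointwise convergence. -/
theorem isAdapted_ellisGroup_iff (hequi : IsEquicontinuous Φ) {U : Set X} :
    IsAdapted (ellisGroup Φ hequi).subtype U ↔ IsAdapted Φ U := by
  constructor
  · exact fun h => ⟨h.1, h.2.1, fun γ => h.2.2 ⟨Φ γ, range_le_ellisGroup hequi ⟨γ, rfl⟩⟩⟩
  · intro hU
    have key : ∀ g ∈ ellisGroup Φ hequi, ∀ y ∈ U, g y ∈ U → ∀ z ∈ U, g z ∈ U := by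
      intro g hg y hy hgy z hz
      by_contra hgz
      have hopen : IsOpen ((fun f : X → X => f y) ⁻¹' U ∩ (fun f : X → X => f z) ⁻¹' Uᶜ) :=
        (hU.1.2.preimage (continuous_apply y)).inter
          (hU.1.1.isOpen_compl.preimage (continuous_apply z))
      obtain ⟨_, hf, _, ⟨γ, rfl⟩, rfl⟩ := mem_closure_iff.1 hg _ hopen ⟨hgy, hgz⟩
      exact hf.2 (hU.apply_mem hy hf.1 hz)
    refine ⟨hU.1, hU.2.1, fun g => or_iff_not_imp_right.2 fun h => ?_⟩
    obtain ⟨_, ⟨y, hy, rfl⟩, hgy⟩ := not_disjoint_iff.1 h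
    refine Subset.antisymm (image_subset_iff.2 fun z hz => key _ g.2 y hy hgy z hz) fun z hz => ?_
    refine ⟨g.1⁻¹ z, key _ ((ellisGroup Φ hequi).inv_mem g.2) (g.1 y) hgy ?_ z hz, ?_⟩
    · change g.1.symm (g.1 y) ∈ U
      rwa [Homeomorph.symm_apply_apply]
    · exact g.1.apply_symm_apply z

end Ellis

/-! ### Boundedness, finiteness and flatness without a base point -/

section Types

variable {Γ : Type w} [Group Γ] {X : Type u} [TopologicalSpace X] {Φ : Γ →* (X ≃ₜ X)}

/-- An element of `D` that is the identity on some adapted subset of the adapted set `U` is the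
identity on `U`. -/
def IsRigidOn (Φ : Γ →* (X ≃ₜ X)) (D : Subgroup (X ≃ₜ X)) (U : Set X) : Prop :=
  IsAdapted Φ U ∧ ∀ V, IsAdapted Φ V → V ⊆ U → fixator D V ≤ fixator D U

/-- The fixators in `D` of all adapted sets are finite. -/
def HasFiniteFixators (Φ : Γ →* (X ≃ₜ X)) (D : Subgroup (X ≃ₜ X)) : Prop :=
  ∀ U, IsAdapted Φ U → Finite (fixator D U)

/-- An element of `D` that is the identity near a point `y` commutes with the return times to some
adapted neighbourhood of `y`. -/
def IsFlat (Φ : Γ →* (X ≃ₜ X)) (D : Subgroup (X ≃ₜ X)) : Prop :=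
  ∀ U, IsAdapted Φ U → ∀ φ ∈ fixator D U, ∀ y ∈ U,
    ∃ V, IsAdapted Φ V ∧ y ∈ V ∧ φ ∈ Subgroup.centralizer (returnTimes Φ V)

theorem fixator_mono {D D' : Subgroup (X ≃ₜ X)} (h : D ≤ D') (U : Set X) :
    fixator D U ≤ fixator D' U :=
  fun _ hφ => ⟨h hφ.1, hφ.2⟩

theorem IsRigidOn.anti {D D' : Subgroup (X ≃ₜ X)} (h : D ≤ D') {U : Set X}
    (hU : IsRigidOn Φ D' U) : IsRigidOn Φ D U :=
  ⟨hU.1, fun V hV hVU _ hφ => ⟨hφ.1, (hU.2 V hV hVU (fixator_mono h V hφ)).2⟩⟩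

theorem HasFiniteFixators.anti {D D' : Subgroup (X ≃ₜ X)} (h : D ≤ D')
    (hfin : HasFiniteFixators Φ D') : HasFiniteFixators Φ D := fun U hU =>
  have : Finite (fixator D' U) := hfin U hU
  Finite.of_injective _ (Subgroup.inclusion_injective (fixator_mono h U))

theorem IsFlat.anti {D D' : Subgroup (X ≃ₜ X)} (h : D ≤ D') (hflat : IsFlat Φ D') :
    IsFlat Φ D :=
  fun U hU φ hφ => hflat U hU φ (fixator_mono h U hφ)

theorem IsRigidOn.image {D : Subgroup (X ≃ₜ X)} (hD : Φ.range ≤ D) {U : Set X}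
    (hU : IsRigidOn Φ D U) (γ : Γ) : IsRigidOn Φ D (Φ γ '' U) := by
  refine ⟨hU.1.image γ, fun V hV hVU φ hφ => ?_⟩
  have hV' : V = Φ γ '' (Φ γ⁻¹ '' V) := by
    rw [← action_image_mul, mul_inv_cancel, map_one]
    exact (image_id V).symm
  rw [hV', mem_fixator_image_iff hD] at hφ
  refine (mem_fixator_image_iff hD γ).2 (hU.2 _ (hV.image γ⁻¹) ?_ hφ)
  refine image_subset_iff.2 fun z hz => ?_
  exact (mem_action_image_iff Φ γ).1 (hVU hz)

theorem isBoundedChain_fixator_iff [CompactSpace X] (hmin : IsMinimal Φ)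
    {D : Subgroup (X ≃ₜ X)} (hD : Φ.range ≤ D) {x : X} (B : AdaptedBasis Φ x) :
    IsBoundedChain (fun n => fixator D (B.U n)) ↔ ∃ U, IsRigidOn Φ D U := by
  constructor
  · rintro ⟨k, hk⟩
    refine ⟨B.U k, B.adapted k, fun V hV hVU φ hφ => ?_⟩
    obtain ⟨γ, hγ⟩ := hmin.exists_mem x hV.1.2 hV.2.1
    obtain ⟨m, hm⟩ := B.exists_image_subset γ (hV.1.2.mem_nhds hγ)
    have h1 : (Φ γ)⁻¹ * φ * Φ γ ∈ fixator D (B.U (max k m)) :=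
      (mem_fixator_image_iff hD γ).1 (fixator_anti D
        ((image_mono (B.antitone (le_max_right k m))).trans hm) hφ)
    have hk' : fixator D (B.U k) = fixator D (B.U (max k m)) := hk k _ le_rfl (le_max_left k m)
    rw [← hk', ← mem_fixator_image_iff hD] at h1
    -- `x` and `γ x` both lie in `U k`, so `γ` preserves it.
    rwa [(B.adapted k).image_eq (B.mem k) (hVU hγ)] at h1
  · rintro ⟨U, hU⟩
    obtain ⟨γ, hγ⟩ := hmin.exists_mem x hU.1.1.2 hU.1.2.1
    have hxU : x ∈ Φ γ⁻¹ '' U := by rwa [mem_action_image_iff, inv_inv]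
    have hU' := hU.image hD γ⁻¹
    obtain ⟨k, hk⟩ := B.exists_subset (hU'.1.1.2.mem_nhds hxU)
    refine ⟨k, fun m n hm hmn => le_antisymm (fixator_anti D (B.antitone hmn)) ?_⟩
    exact (hU'.2 _ (B.adapted n) ((B.antitone (hm.trans hmn)).trans hk)).trans
      (fixator_anti D ((B.antitone hm).trans hk))

theorem finite_fixator_iff [CompactSpace X] (hmin : IsMinimal Φ)
    {D : Subgroup (X ≃ₜ X)} (hD : Φ.range ≤ D) {x : X} (B : AdaptedBasis Φ x) :
    (∀ n, Finite (fixator D (B.U n))) ↔ HasFiniteFixators Φ D := by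
  refine ⟨fun h U hU => ?_, fun h n => h _ (B.adapted n)⟩
  obtain ⟨γ, hγ⟩ := hmin.exists_mem x hU.1.2 hU.2.1
  obtain ⟨n, hn⟩ := B.exists_image_subset γ (hU.1.2.mem_nhds hγ)
  have := h n
  refine Finite.of_injective (β := fixator D (B.U n)) (fun φ => ⟨(Φ γ)⁻¹ * φ.1 * Φ γ,
    (mem_fixator_image_iff hD γ).1 (fixator_anti D hn φ.2)⟩) fun φ ψ h => ?_
  have h' := congrArg Subtype.val h
  exact Subtype.ext (mul_left_cancel (mul_right_cancel h'))

/-- The group elements whose action commutes with a homeomorphism `φ`. -/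
def commutingSubgroup (Φ : Γ →* (X ≃ₜ X)) (φ : X ≃ₜ X) : Subgroup Γ :=
  (Subgroup.centralizer {φ}).comap Φ

theorem mem_commutingSubgroup {φ : X ≃ₜ X} {γ : Γ} :
    γ ∈ commutingSubgroup Φ φ ↔ Φ γ * φ = φ * Φ γ := by
  rw [commutingSubgroup, Subgroup.mem_comap, Subgroup.mem_centralizer_singleton_iff]

theorem finiteIndex_commutingSubgroup [CompactSpace X] (hmin : IsMinimal Φ) {W : Set X}
    (hW : IsAdapted Φ W) {φ : X ≃ₜ X} (hφ : φ ∈ Subgroup.centralizer (returnTimes Φ W)) :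
    (commutingSubgroup Φ φ).FiniteIndex :=
  finiteIndex_of_returnTimes hmin hW fun _ hγ =>
    mem_commutingSubgroup.2 (Subgroup.mem_centralizer_iff.1 hφ _ hγ)

/-- Flatness passes from one point to another: if `φ` centralizes the return times to small
neighbourhoods of all points of `U` in the orbit of `x`, then the elements commuting with `φ` have
finite index, so some `k` among them moves a given `y ∈ U` into such a neighbourhood `W`, and the
return times to `k⁻¹ W` are conjugate by `k⁻¹` to those to `W`. -/
theorem iSup_centralFixator_eq_iff [CompactSpace X] [T2Space X] (hmin : IsMinimal Φ)
    {D : Subgroup (X ≃ₜ X)} (hD : Φ.range ≤ D) {x : X} (B : AdaptedBasis Φ x) :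
    (⨆ n, centralFixator Φ D (B.U n)) = (⨆ n, fixator D (B.U n)) ↔ IsFlat Φ D := by
  have hZ : Monotone fun n => centralFixator Φ D (B.U n) :=
    fun m n h => centralFixator_anti D (B.antitone h)
  have hK : Monotone fun n => fixator D (B.U n) := fun m n h => fixator_anti D (B.antitone h)
  constructor
  · intro h U hU φ hφ y hy
    have hloc : ∀ O, IsOpen O → O.Nonempty → O ⊆ U →
        ∃ W, IsAdapted Φ W ∧ W ⊆ O ∧ φ ∈ Subgroup.centralizer (returnTimes Φ W) := by
      intro O hO hne hOU
      obtain ⟨γ, hγ⟩ := hmin.exists_mem x hO hne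
      obtain ⟨n, hn⟩ := B.exists_image_subset γ (hO.mem_nhds hγ)
      have h1 : (Φ γ)⁻¹ * φ * Φ γ ∈ ⨆ n, fixator D (B.U n) :=
        Subgroup.mem_iSup_of_mem n ((mem_fixator_image_iff hD γ).1
          (fixator_anti D (hn.trans hOU) hφ))
      rw [← h, Subgroup.mem_iSup_of_directed hZ.directed_le] at h1
      obtain ⟨m, hm⟩ := h1
      have h2 := conj_mem_centralizer_image γ (hZ (le_max_right n m) hm).2
      rw [show Φ γ * ((Φ γ)⁻¹ * φ * Φ γ) * (Φ γ)⁻¹ = φ by group] at h2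
      exact ⟨_, (B.adapted _).image γ, (image_mono (B.antitone (le_max_left n m))).trans hn, h2⟩
    obtain ⟨W₀, hW₀, -, hφ₀⟩ := hloc U hU.1.2 ⟨y, hy⟩ Subset.rfl
    have := finiteIndex_commutingSubgroup hmin hW₀ hφ₀
    obtain ⟨O, hOsub, hO, hyO⟩ := mem_nhds_iff.1 (inter_mem (hU.1.2.mem_nhds hy)
      (closure_orbit_mem_nhds hmin (commutingSubgroup Φ φ) y))
    obtain ⟨W, hW, hWO, hφW⟩ := hloc O hO ⟨y, hyO⟩ fun z hz => (hOsub hz).1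
    obtain ⟨w, hw⟩ := hW.2.1
    obtain ⟨_, hkW, k, hk, rfl⟩ := mem_closure_iff.1 (hOsub (hWO hw)).2 W hW.1.2 hw
    refine ⟨Φ k⁻¹ '' W, hW.image _, by rwa [mem_action_image_iff, inv_inv], ?_⟩
    have h3 := conj_mem_centralizer_image k⁻¹ hφW
    rwa [← map_inv, inv_inv,
      mem_commutingSubgroup.1 ((commutingSubgroup Φ φ).inv_mem hk), mul_assoc, ← map_mul,
      inv_mul_cancel, map_one, mul_one] at h3
  · refine fun h => le_antisymm (iSup_mono fun n => inf_le_left) fun φ hφ => ?_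
    obtain ⟨n, hn⟩ := (Subgroup.mem_iSup_of_directed hK.directed_le).1 hφ
    obtain ⟨V, hV, hxV, hφV⟩ := h _ (B.adapted n) φ hn x (B.mem n)
    obtain ⟨m, hm⟩ := B.exists_subset (hV.1.2.mem_nhds hxV)
    refine Subgroup.mem_iSup_of_mem (max n m) ⟨hK (le_max_left n m) hn, ?_⟩
    exact Subgroup.centralizer_le
      (returnTimes_mono ((B.antitone (le_max_right n m)).trans hm)) hφV

end Types

/-! ### Local quasi-analyticity -/

section LQA

variable {Γ : Type w} [Group Γ] {X : Type u} [MetricSpace X] [CompactSpace X]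
  {Φ : Γ →* (X ≃ₜ X)}

/-- Sets of small diameter lie in a translate of a rigid set, by the Lebesgue number lemma. -/
theorem isLQA_iff_isRigidOn (hmin : IsMinimal Φ) {Λ : Type*} [Group Λ] (Ψ : Λ →* (X ≃ₜ X))
    (hΨ : Φ.range ≤ Ψ.range) (hadapted : ∀ U, IsAdapted Ψ U ↔ IsAdapted Φ U) {x : X}
    (B : AdaptedBasis Φ x) : IsLQA Ψ ↔ ∃ U, IsRigidOn Φ Ψ.range U := by
  constructor
  · rintro ⟨ε, hε, h⟩
    obtain ⟨n, hn⟩ := B.exists_subset (Metric.ball_mem_nhds x (by positivity : 0 < ε / 3))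
    have hdiam : Metric.diam (B.U n) < ε := by
      have h1 := (Metric.diam_mono hn Metric.isBounded_ball).trans
        (Metric.diam_ball (by positivity : 0 ≤ ε / 3))
      linarith
    refine ⟨B.U n, B.adapted n, ?_⟩
    rintro V hV hVU _ ⟨⟨g, rfl⟩, hg⟩
    refine ⟨⟨g, rfl⟩, ?_⟩
    have h2 := h _ ((hadapted _).2 (B.adapted n)) hdiam V ((hadapted _).2 hV) hVU g 1
    rw [map_one] at h2
    exact h2 hg
  · rintro ⟨U, hU⟩
    obtain ⟨ε, hε, hcov⟩ := lebesgue_number_lemma_of_metric (isCompact_univ (X := X))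
      (fun γ : Γ => (hU.1.image γ).1.2) (fun y _ => mem_iUnion.2 (by
        obtain ⟨γ, hγ⟩ := hmin.exists_mem y hU.1.1.2 hU.1.2.1
        exact ⟨γ⁻¹, by rwa [mem_action_image_iff, inv_inv]⟩))
    refine ⟨ε, hε, fun A hA hdiam V hV hVA g₁ g₂ hg => ?_⟩
    obtain ⟨a, ha⟩ := hA.2.1
    obtain ⟨γ, hγ⟩ := hcov a (mem_univ a)
    have hAU : A ⊆ Φ γ '' U := fun z hz => hγ (Metric.mem_ball.2
      ((Metric.dist_le_diam_of_mem hA.1.1.isCompact.isBounded hz ha).trans_lt hdiam))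
    have h1 : Ψ (g₂⁻¹ * g₁) ∈ fixator Ψ.range V :=
      ⟨⟨_, rfl⟩, fun z hz => by rw [action_mul_apply, hg hz, action_inv_apply_self, id]⟩
    have h2 := (hU.image hΨ γ).2 V ((hadapted V).1 hV) (hVA.trans hAU) h1
    intro z hz
    have h3 := h2.2 (hAU hz)
    rw [action_mul_apply] at h3
    rw [← action_apply_inv_self Ψ g₂ (Ψ g₁ z), h3, id]

end LQA

/-! ### Characterization of the classes -/

theorem exists_basis_iff {Γ : Type w} [Group Γ] {X : Type u} [TopologicalSpace X]
    {Φ : Γ →* (X ≃ₜ X)} {P : ∀ {x : X}, AdaptedBasis Φ x → Prop} {Q : Prop}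
    (h : ∀ {x : X} (B : AdaptedBasis Φ x), P B ↔ Q) {x : X} (B : AdaptedBasis Φ x) :
    (∃ (x : X) (B : AdaptedBasis Φ x), P B) ↔ Q :=
  ⟨fun ⟨_, B', hB'⟩ => (h B').1 hB', fun hQ => ⟨x, B, (h B).2 hQ⟩⟩

section Classes

variable {Γ : Type w} [Group Γ] {X : Type u} [MetricSpace X] [CompactSpace X]
  {Φ : Γ →* (X ≃ₜ X)}

theorem isLQA_iff (hmin : IsMinimal Φ) {x : X} (B : AdaptedBasis Φ x) :
    IsLQA Φ ↔ ∃ U, IsRigidOn Φ Φ.range U :=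
  isLQA_iff_isRigidOn hmin Φ le_rfl (fun _ => Iff.rfl) B

theorem isWild_iff (hmin : IsMinimal Φ) (hequi : IsEquicontinuous Φ) {x : X}
    (B : AdaptedBasis Φ x) :
    IsWild Φ hequi ↔ ¬ ∃ U, IsRigidOn Φ (ellisGroup Φ hequi) U := by
  have h := isLQA_iff_isRigidOn hmin (ellisGroup Φ hequi).subtype
    (by rw [Subgroup.range_subtype]; exact range_le_ellisGroup hequi)
    (fun U => isAdapted_ellisGroup_iff hequi) B
  rw [Subgroup.range_subtype] at h
  rw [IsWild, h]

theorem countablyWildFiniteAt_iff (hmin : IsMinimal Φ) {x : X} (B : AdaptedBasis Φ x) :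
    CountablyWildFiniteAt Φ B ↔
      (¬ ∃ U, IsRigidOn Φ Φ.range U) ∧ HasFiniteFixators Φ Φ.range := by
  rw [CountablyWildFiniteAt, IsFiniteType, isLQA_iff hmin B,
    funext (countableStab_eq_fixator hmin B), isBoundedChain_fixator_iff hmin le_rfl B,
    finite_fixator_iff hmin le_rfl B, and_self_left]

theorem countablyWildFlatAt_iff (hmin : IsMinimal Φ) {x : X} (B : AdaptedBasis Φ x) :
    CountablyWildFlatAt Φ B ↔ (¬ ∃ U, IsRigidOn Φ Φ.range U) ∧ IsFlat Φ Φ.range := by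
  rw [CountablyWildFlatAt, IsFlatType, isLQA_iff hmin B,
    funext (countableStab_eq_fixator hmin B), funext (countableCent_eq_centralFixator hmin B),
    isBoundedChain_fixator_iff hmin le_rfl B, iSup_centralFixator_eq_iff hmin le_rfl B,
    and_self_left]

theorem countablyDynamicallyWildAt_iff (hmin : IsMinimal Φ) {x : X} (B : AdaptedBasis Φ x) :
    CountablyDynamicallyWildAt Φ B ↔
      (¬ ∃ U, IsRigidOn Φ Φ.range U) ∧ ¬ IsFlat Φ Φ.range := by
  rw [CountablyDynamicallyWildAt, IsDynamicType, isLQA_iff hmin B,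
    funext (countableStab_eq_fixator hmin B), funext (countableCent_eq_centralFixator hmin B),
    isBoundedChain_fixator_iff hmin le_rfl B, ne_eq, iSup_centralFixator_eq_iff hmin le_rfl B,
    and_self_left]

theorem wildFiniteAt_iff (hmin : IsMinimal Φ) (hequi : IsEquicontinuous Φ) {x : X}
    (B : AdaptedBasis Φ x) :
    WildFiniteAt Φ hequi B ↔ (¬ ∃ U, IsRigidOn Φ (ellisGroup Φ hequi) U) ∧
      HasFiniteFixators Φ (ellisGroup Φ hequi) := by
  rw [WildFiniteAt, IsFiniteType, isWild_iff hmin hequi B,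
    funext (profiniteStab_eq_fixator hmin hequi B),
    isBoundedChain_fixator_iff hmin (range_le_ellisGroup hequi) B,
    finite_fixator_iff hmin (range_le_ellisGroup hequi) B, and_self_left]

theorem wildFlatAt_iff (hmin : IsMinimal Φ) (hequi : IsEquicontinuous Φ) {x : X}
    (B : AdaptedBasis Φ x) :
    WildFlatAt Φ hequi B ↔ (¬ ∃ U, IsRigidOn Φ (ellisGroup Φ hequi) U) ∧
      IsFlat Φ (ellisGroup Φ hequi) := by
  rw [WildFlatAt, IsFlatType, isWild_iff hmin hequi B,
    funext (profiniteStab_eq_fixator hmin hequi B),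
    funext (profiniteCent_eq_centralFixator hmin hequi B),
    isBoundedChain_fixator_iff hmin (range_le_ellisGroup hequi) B,
    iSup_centralFixator_eq_iff hmin (range_le_ellisGroup hequi) B, and_self_left]

theorem dynamicallyWildAt_iff (hmin : IsMinimal Φ) (hequi : IsEquicontinuous Φ) {x : X}
    (B : AdaptedBasis Φ x) :
    DynamicallyWildAt Φ hequi B ↔ (¬ ∃ U, IsRigidOn Φ (ellisGroup Φ hequi) U) ∧
      ¬ IsFlat Φ (ellisGroup Φ hequi) := by
  rw [DynamicallyWildAt, IsDynamicType, isWild_iff hmin hequi B,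
    funext (profiniteStab_eq_fixator hmin hequi B),
    funext (profiniteCent_eq_centralFixator hmin hequi B),
    isBoundedChain_fixator_iff hmin (range_le_ellisGroup hequi) B, ne_eq,
    iSup_centralFixator_eq_iff hmin (range_le_ellisGroup hequi) B, and_self_left]

end Classes

/-! ### Non-Hausdorff elements and the germinal groupoid -/

section Germs

variable {Γ : Type w} [Group Γ] {X : Type u} [TopologicalSpace X] {Φ : Γ →* (X ≃ₜ X)}

theorem AdaptedBasis.exists_isAdapted_subset [CompactSpace X] (hmin : IsMinimal Φ) {x : X}
    (B : AdaptedBasis Φ x) {O : Set X} (hO : IsOpen O) (hne : O.Nonempty) :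
    ∃ V, IsAdapted Φ V ∧ V ⊆ O := by
  obtain ⟨γ, hγ⟩ := hmin.exists_mem x hO hne
  obtain ⟨n, hn⟩ := B.exists_image_subset γ (hO.mem_nhds hγ)
  exact ⟨_, (B.adapted n).image γ, hn⟩

theorem IsNonHausdorffAt.not_isRigidOn [CompactSpace X] (hmin : IsMinimal Φ) {x₀ : X}
    (B : AdaptedBasis Φ x₀) {g : Γ} {x : X} (hg : IsNonHausdorffAt Φ g x) :
    ¬ ∃ U, IsRigidOn Φ Φ.range U := by
  rintro ⟨U, hU⟩
  obtain ⟨γ, hγ⟩ := hmin.exists_mem x hU.1.1.2 hU.1.2.1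
  have hx : x ∈ Φ γ⁻¹ '' U := by rwa [mem_action_image_iff, inv_inv]
  have hU' := hU.image le_rfl γ⁻¹
  obtain ⟨O, hO, hne, hOU, hgO⟩ := hg.2.2 _ hU'.1.1.2 hx
  obtain ⟨V, hV, hVO⟩ := B.exists_isAdapted_subset hmin hO hne
  exact hg.2.1 _ hU'.1.1.2 hx (hU'.2 V hV (hVO.trans hOU) ⟨⟨g, rfl⟩, hgO.mono hVO⟩).2

/-- If the action were flat, the elements commuting with a non-Hausdorff element `g` at `x` would
have finite index. One of them would move `x` into an open set on which `g` is the identity, and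
`g` would be the identity near `x`. -/
theorem IsNonHausdorffAt.not_isFlat [CompactSpace X] [T2Space X] (hmin : IsMinimal Φ) {x₀ : X}
    (B : AdaptedBasis Φ x₀) {g : Γ} {x : X} (hg : IsNonHausdorffAt Φ g x) :
    ¬ IsFlat Φ Φ.range := by
  intro hflat
  obtain ⟨O, hO, hne, -, hgO⟩ := hg.2.2 univ isOpen_univ (mem_univ x)
  obtain ⟨V, hV, hVO⟩ := B.exists_isAdapted_subset hmin hO hne
  obtain ⟨v, hv⟩ := hV.2.1
  obtain ⟨W, hW, -, hgW⟩ := hflat V hV (Φ g) ⟨⟨g, rfl⟩, hgO.mono hVO⟩ v hv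
  have := finiteIndex_commutingSubgroup hmin hW hgW
  obtain ⟨A, hAsub, hA, hxA⟩ :=
    mem_nhds_iff.1 (closure_orbit_mem_nhds hmin (commutingSubgroup Φ (Φ g)) x)
  obtain ⟨O', hO', ⟨z, hz⟩, hO'A, hgO'⟩ := hg.2.2 A hA hxA
  obtain ⟨_, hkO', k, hk, rfl⟩ := mem_closure_iff.1 (hAsub (hO'A hz)) O' hO' hz
  refine hg.2.1 (Φ k ⁻¹' O') (hO'.preimage (Φ k).continuous) hkO' fun y hy => ?_
  have h1 : Φ k (Φ g y) = Φ g (Φ k y) := DFunLike.congr_fun (mem_commutingSubgroup.1 hk) y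
  exact (Φ k).injective (h1.trans (hgO' hy))

theorem germ_eq_iff {g h : Γ} {x y : X} : germ Φ g x = germ Φ h y ↔
    x = y ∧ ∃ U : Set X, IsOpen U ∧ x ∈ U ∧ EqOn (Φ g) (Φ h) U :=
  Quotient.eq (r := germSetoid Φ)

theorem isOpen_image_germ (g : Γ) {U : Set X} (hU : IsOpen U) : IsOpen (germ Φ g '' U) :=
  TopologicalSpace.isOpen_generateFrom_of_mem ⟨g, U, hU, rfl⟩

theorem t2Space_germinalGroupoid [T2Space X]
    (h : ¬ ∃ (g : Γ) (x : X), IsNonHausdorffAt Φ g x) : T2Space (GerminalGroupoid Φ) := by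
  refine ⟨fun p q => ?_⟩
  obtain ⟨⟨g₁, x⟩, rfl⟩ := Quotient.exists_rep p
  obtain ⟨⟨g₂, y⟩, rfl⟩ := Quotient.exists_rep q
  change germ Φ g₁ x ≠ germ Φ g₂ y → _
  intro hpq
  change ∃ A B, IsOpen A ∧ IsOpen B ∧ germ Φ g₁ x ∈ A ∧ germ Φ g₂ y ∈ B ∧ Disjoint A B
  by_cases hxy : x = y
  · subst hxy
    -- It suffices to find a neighbourhood on which `g₁` and `g₂` have no germ in common.
    suffices hW : ∃ W, IsOpen W ∧ x ∈ W ∧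
        ∀ O, IsOpen O → O ⊆ W → EqOn (Φ g₁) (Φ g₂) O → ¬ O.Nonempty by
      obtain ⟨W, hWo, hxW, hW⟩ := hW
      refine ⟨_, _, isOpen_image_germ g₁ hWo, isOpen_image_germ g₂ hWo,
        mem_image_of_mem _ hxW, mem_image_of_mem _ hxW, disjoint_left.2 ?_⟩
      rintro _ ⟨z, hz, rfl⟩ ⟨z', hz', hzz'⟩
      obtain ⟨rfl, O, hO, hzO, he⟩ := germ_eq_iff.1 hzz'
      exact hW (O ∩ W) (hO.inter hWo) inter_subset_right
        (he.symm.mono inter_subset_left) ⟨z', hzO, hz'⟩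
    by_contra hW
    push Not at hW
    refine h ⟨g₂⁻¹ * g₁, x, ?_, fun W hWo hxW he => hpq ?_, fun W hWo hxW => ?_⟩
    · by_contra hne
      have hne' : Φ g₁ x ≠ Φ g₂ x := fun he => hne (by
        rw [action_mul_apply, he, action_inv_apply_self])
      obtain ⟨O, -, hOW, he, z, hz⟩ := hW {z | Φ g₁ z ≠ Φ g₂ z}
        (isOpen_ne_fun (Φ g₁).continuous (Φ g₂).continuous) hne'
      exact hOW hz (he hz)
    · refine germ_eq_iff.2 ⟨rfl, W, hWo, hxW, fun z hz => ?_⟩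
      rw [← action_apply_inv_self Φ g₂ (Φ g₁ z), ← action_mul_apply Φ g₂⁻¹,
        he hz, id]
    · obtain ⟨O, hO, hOW, he, hne⟩ := hW W hWo hxW
      refine ⟨O, hO, hne, hOW, fun z hz => ?_⟩
      rw [action_mul_apply, he hz, action_inv_apply_self, id]
  · obtain ⟨U, V, hU, hV, hxU, hyV, hUV⟩ := t2_separation hxy
    refine ⟨_, _, isOpen_image_germ g₁ hU, isOpen_image_germ g₂ hV,
      mem_image_of_mem _ hxU, mem_image_of_mem _ hyV, disjoint_left.2 ?_⟩
    rintro _ ⟨z, hz, rfl⟩ ⟨z', hz', hzz'⟩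
    obtain ⟨rfl, -⟩ := germ_eq_iff.1 hzz'
    exact disjoint_left.1 hUV hz hz'

end Germs

/-! ### Conjugate actions -/

section Conjugacy

variable {Γ : Type w} [Group Γ] {X : Type u} [TopologicalSpace X] {Y : Type v}
  [TopologicalSpace Y] {Φ : Γ →* (X ≃ₜ X)} {Ψ : Γ →* (Y ≃ₜ Y)}

theorem Conjugate.symm (h : Conjugate Φ Ψ) : Conjugate Ψ Φ := by
  obtain ⟨f, hf⟩ := h
  refine ⟨f.symm, fun γ y => ?_⟩
  rw [Homeomorph.symm_apply_eq, hf, Homeomorph.apply_symm_apply]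

theorem image_action_image {f : X ≃ₜ Y} (hf : ∀ γ x, f (Φ γ x) = Ψ γ (f x)) (γ : Γ)
    (U : Set X) : Ψ γ '' (f '' U) = f '' (Φ γ '' U) := by
  rw [image_image, image_image]
  exact image_congr fun x _ => (hf γ x).symm

theorem symm_apply_action {f : X ≃ₜ Y} (hf : ∀ γ x, f (Φ γ x) = Ψ γ (f x)) (γ : Γ)
    (y : Y) : f.symm (Ψ γ y) = Φ γ (f.symm y) := by
  rw [Homeomorph.symm_apply_eq, hf, Homeomorph.apply_symm_apply]

theorem isAdapted_image_iff {f : X ≃ₜ Y} (hf : ∀ γ x, f (Φ γ x) = Ψ γ (f x)) {U : Set X} :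
    IsAdapted Ψ (f '' U) ↔ IsAdapted Φ U := by
  rw [IsAdapted, IsAdapted, IsClopen, IsClopen, f.isClosed_image, f.isOpen_image, image_nonempty]
  simp only [image_action_image hf, f.injective.image_injective.eq_iff,
    disjoint_image_iff f.injective]

theorem isAdapted_preimage_iff {f : X ≃ₜ Y} (hf : ∀ γ x, f (Φ γ x) = Ψ γ (f x)) {U : Set Y} :
    IsAdapted Φ (f ⁻¹' U) ↔ IsAdapted Ψ U := by
  rw [← isAdapted_image_iff hf, image_preimage_eq U f.surjective]

theorem isMinimal_of_conjugate {f : X ≃ₜ Y} (hf : ∀ γ x, f (Φ γ x) = Ψ γ (f x))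
    (hmin : IsMinimal Φ) : IsMinimal Ψ := by
  intro y
  have h := f.surjective.denseRange.dense_image f.continuous (hmin (f.symm y))
  rwa [← range_comp, show f ∘ (fun γ => Φ γ (f.symm y)) = fun γ => Ψ γ y from funext fun γ => by
    rw [Function.comp_apply, hf, f.apply_symm_apply]] at h

/-- The image of an adapted neighbourhood basis under a conjugacy. -/
def AdaptedBasis.map {f : X ≃ₜ Y} (hf : ∀ γ x, f (Φ γ x) = Ψ γ (f x)) {x : X}
    (B : AdaptedBasis Φ x) : AdaptedBasis Ψ (f x) where
  U n := f '' B.U n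
  zero := by rw [B.zero, image_univ_of_surjective f.surjective]
  adapted n := (isAdapted_image_iff hf).2 (B.adapted n)
  mem n := mem_image_of_mem f (B.mem n)
  ssubset n := f.injective.image_strictMono (B.ssubset n)
  iInter := by rw [← image_iInter f.bijective, B.iInter, image_singleton]

theorem mem_fixator_range_preimage_iff {f : X ≃ₜ Y} (hf : ∀ γ x, f (Φ γ x) = Ψ γ (f x)) {γ : Γ}
    {U : Set Y} : Φ γ ∈ fixator Φ.range (f ⁻¹' U) ↔ Ψ γ ∈ fixator Ψ.range U := by
  refine and_congr (iff_of_true ⟨γ, rfl⟩ ⟨γ, rfl⟩) ⟨fun h y hy => ?_, fun h x hx => ?_⟩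
  · have h1 : Φ γ (f.symm y) = f.symm y := h (by rwa [mem_preimage, f.apply_symm_apply])
    rw [← symm_apply_action hf] at h1
    exact f.symm.injective h1
  · have h1 : Ψ γ (f x) = f x := h hx
    rw [← hf] at h1
    exact f.injective h1

theorem exists_isRigidOn_of_conjugate (h : Conjugate Φ Ψ) (hU : ∃ U, IsRigidOn Ψ Ψ.range U) :
    ∃ U, IsRigidOn Φ Φ.range U := by
  obtain ⟨f, hf⟩ := h
  obtain ⟨U, hU, hrigid⟩ := hU
  refine ⟨f ⁻¹' U, (isAdapted_preimage_iff hf).2 hU, ?_⟩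
  rintro V hV hVU _ ⟨⟨γ, rfl⟩, hγ⟩
  rw [← f.preimage_image V] at hγ
  rw [mem_fixator_range_preimage_iff hf]
  exact hrigid _ ((isAdapted_image_iff hf).2 hV) (image_subset_iff.2 hVU)
    ((mem_fixator_range_preimage_iff hf).1 ⟨⟨γ, rfl⟩, hγ⟩)

theorem HasFiniteFixators.of_conjugate (h : Conjugate Φ Ψ)
    (hfin : HasFiniteFixators Φ Φ.range) : HasFiniteFixators Ψ Ψ.range := by
  obtain ⟨f, hf⟩ := h
  intro U hU
  have : Finite (fixator Φ.range (f ⁻¹' U)) := hfin _ ((isAdapted_preimage_iff hf).2 hU)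
  refine (((fixator Φ.range (f ⁻¹' U) : Set (X ≃ₜ X)).toFinite.image
    fun φ => (f.symm.trans φ).trans f).subset ?_).to_subtype
  rintro _ ⟨⟨γ, rfl⟩, hγ⟩
  refine ⟨Φ γ, (mem_fixator_range_preimage_iff hf).2 ⟨⟨γ, rfl⟩, hγ⟩, ?_⟩
  ext y
  change f (Φ γ (f.symm y)) = Ψ γ y
  rw [hf, f.apply_symm_apply]

theorem IsFlat.of_conjugate (h : Conjugate Φ Ψ) (hflat : IsFlat Φ Φ.range) :
    IsFlat Ψ Ψ.range := by
  obtain ⟨f, hf⟩ := h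
  rintro U hU _ ⟨⟨γ, rfl⟩, hγ⟩ y hy
  obtain ⟨V, hV, hyV, hγV⟩ := hflat (f ⁻¹' U) ((isAdapted_preimage_iff hf).2 hU) (Φ γ)
    ((mem_fixator_range_preimage_iff hf).2 ⟨⟨γ, rfl⟩, hγ⟩) (f.symm y)
    (by rwa [mem_preimage, f.apply_symm_apply])
  refine ⟨f '' V, (isAdapted_image_iff hf).2 hV, ⟨_, hyV, f.apply_symm_apply y⟩, ?_⟩
  rw [Subgroup.mem_centralizer_iff] at hγV ⊢
  rintro _ ⟨⟨δ, rfl⟩, hδ⟩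
  rw [image_action_image hf, ← image_inter f.injective, image_nonempty] at hδ
  have h1 := hγV (Φ δ) ⟨⟨δ, rfl⟩, hδ⟩
  ext z
  obtain ⟨t, rfl⟩ := f.surjective z
  have h2 : Φ δ (Φ γ t) = Φ γ (Φ δ t) := DFunLike.congr_fun h1 t
  rw [Homeomorph.mul_apply, Homeomorph.mul_apply, ← hf, ← hf, h2, hf, hf]

end Conjugacy

end CantorAction

theorem theorem1p1 {Γ : Type w} [Group Γ] [Countable Γ]
    {X : Type u} [MetricSpace X] [CompactSpace X] [TotallyDisconnectedSpace X] [PerfectSpace X]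
    [Nonempty X] (Φ : Γ →* (X ≃ₜ X))
    (hmin : CantorAction.IsMinimal Φ) (hequi : CantorAction.IsEquicontinuous Φ) :
    -- the classes do not depend on the base point and the adapted neighbourhood basis
    (∀ (x : X) (B : CantorAction.AdaptedBasis Φ x),
      (CantorAction.CountablyWildFinite Φ ↔ CantorAction.CountablyWildFiniteAt Φ B) ∧
      (CantorAction.CountablyWildFlat Φ ↔ CantorAction.CountablyWildFlatAt Φ B) ∧
      (CantorAction.CountablyDynamicallyWild Φ ↔ CantorAction.CountablyDynamicallyWildAt Φ B) ∧
      (CantorAction.WildFinite Φ hequi ↔ CantorAction.WildFiniteAt Φ hequi B) ∧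
      (CantorAction.WildFlat Φ hequi ↔ CantorAction.WildFlatAt Φ hequi B) ∧
      (CantorAction.DynamicallyWild Φ hequi ↔ CantorAction.DynamicallyWildAt Φ hequi B)) ∧
    -- (1)
    (∀ (Y : Type v) [MetricSpace Y] (Ψ : Γ →* (Y ≃ₜ Y)), CantorAction.Conjugate Φ Ψ →
      (CantorAction.CountablyWildFinite Φ ↔ CantorAction.CountablyWildFinite Ψ) ∧
      (CantorAction.CountablyWildFlat Φ ↔ CantorAction.CountablyWildFlat Ψ) ∧
      (CantorAction.CountablyDynamicallyWild Φ ↔ CantorAction.CountablyDynamicallyWild Ψ)) ∧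
    -- (2)
    (CantorAction.CountablyWildFlat Φ → T2Space (CantorAction.GerminalGroupoid Φ)) ∧
    -- (3)
    ((∃ (g : Γ) (x : X), CantorAction.IsNonHausdorffAt Φ g x) →
      CantorAction.CountablyDynamicallyWild Φ) ∧
    -- (4)
    (CantorAction.CountablyDynamicallyWild Φ → CantorAction.DynamicallyWild Φ hequi) ∧
    -- (5)
    ((CantorAction.WildFinite Φ hequi →
        CantorAction.IsLQA Φ ∨ CantorAction.CountablyWildFinite Φ) ∧
      (CantorAction.WildFlat Φ hequi →
        CantorAction.IsLQA Φ ∨ CantorAction.CountablyWildFlat Φ)) := by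
  obtain ⟨x₀⟩ := ‹Nonempty X›
  obtain ⟨B₀⟩ := CantorAction.nonempty_adaptedBasis hequi x₀
  have hle := CantorAction.range_le_ellisGroup hequi
  have cFin := CantorAction.exists_basis_iff (CantorAction.countablyWildFiniteAt_iff hmin) B₀
  have cFlat := CantorAction.exists_basis_iff (CantorAction.countablyWildFlatAt_iff hmin) B₀
  have cDyn :=
    CantorAction.exists_basis_iff (CantorAction.countablyDynamicallyWildAt_iff hmin) B₀
  have wFin := CantorAction.exists_basis_iff (CantorAction.wildFiniteAt_iff hmin hequi) B₀
  have wFlat := CantorAction.exists_basis_iff (CantorAction.wildFlatAt_iff hmin hequi) B₀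
  have wDyn := CantorAction.exists_basis_iff (CantorAction.dynamicallyWildAt_iff hmin hequi) B₀
  have hLQA := CantorAction.isLQA_iff hmin B₀
  have hdyn : (∃ (g : Γ) (x : X), CantorAction.IsNonHausdorffAt Φ g x) →
      CantorAction.CountablyDynamicallyWild Φ := fun ⟨_, _, hg⟩ =>
    cDyn.2 ⟨hg.not_isRigidOn hmin B₀, hg.not_isFlat hmin B₀⟩
  refine ⟨fun x B => ⟨?_, ?_, ?_, ?_, ?_, ?_⟩, fun Y _ Ψ hconj => ?_, fun h => ?_, hdyn,
    fun h => wDyn.2 ?_, fun h => ?_, fun h => ?_⟩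
  · exact cFin.trans (CantorAction.countablyWildFiniteAt_iff hmin B).symm
  · exact cFlat.trans (CantorAction.countablyWildFlatAt_iff hmin B).symm
  · exact cDyn.trans (CantorAction.countablyDynamicallyWildAt_iff hmin B).symm
  · exact wFin.trans (CantorAction.wildFiniteAt_iff hmin hequi B).symm
  · exact wFlat.trans (CantorAction.wildFlatAt_iff hmin hequi B).symm
  · exact wDyn.trans (CantorAction.dynamicallyWildAt_iff hmin hequi B).symm
  · obtain ⟨f, hf⟩ := id hconj
    have : CompactSpace Y := f.compactSpace
    have hminΨ := CantorAction.isMinimal_of_conjugate hf hmin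
    have hrigid : (∃ U, CantorAction.IsRigidOn Φ Φ.range U) ↔
        ∃ U, CantorAction.IsRigidOn Ψ Ψ.range U :=
      ⟨CantorAction.exists_isRigidOn_of_conjugate hconj.symm,
        CantorAction.exists_isRigidOn_of_conjugate hconj⟩
    have hfin : CantorAction.HasFiniteFixators Φ Φ.range ↔
        CantorAction.HasFiniteFixators Ψ Ψ.range :=
      ⟨.of_conjugate hconj, .of_conjugate hconj.symm⟩
    have hflat : CantorAction.IsFlat Φ Φ.range ↔ CantorAction.IsFlat Ψ Ψ.range :=
      ⟨.of_conjugate hconj, .of_conjugate hconj.symm⟩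
    have BΨ := B₀.map hf
    refine ⟨cFin.trans (Iff.trans ?_ (CantorAction.exists_basis_iff
        (CantorAction.countablyWildFiniteAt_iff hminΨ) BΨ).symm),
      cFlat.trans (Iff.trans ?_ (CantorAction.exists_basis_iff
        (CantorAction.countablyWildFlatAt_iff hminΨ) BΨ).symm),
      cDyn.trans (Iff.trans ?_ (CantorAction.exists_basis_iff
        (CantorAction.countablyDynamicallyWildAt_iff hminΨ) BΨ).symm)⟩
    · rw [hrigid, hfin]
    · rw [hrigid, hflat]
    · rw [hrigid, hflat]
  · exact CantorAction.t2Space_germinalGroupoid fun hg => (cDyn.1 (hdyn hg)).2 (cFlat.1 h).2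
  · exact ⟨fun ⟨U, hU⟩ => (cDyn.1 h).1 ⟨U, hU.anti hle⟩,
      fun hflat => (cDyn.1 h).2 (hflat.anti hle)⟩
  · exact or_iff_not_imp_left.2 fun hn => cFin.2 ⟨hLQA.not.1 hn, (wFin.1 h).2.anti hle⟩
  · exact or_iff_not_imp_left.2 fun hn => cFlat.2 ⟨hLQA.not.1 hn, (wFlat.1 h).2.anti hle⟩
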